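/- Let $d\in\mathbb{N}$, let $\mathbb{R}_d$ be the real Clifford algebra with units $e_1,\dots,e_d$, $e_i^2=-1$, $e_ie_j=-e_je_i$ for $i\neq j$, basis $e_A$, $A\subseteq\{1,\dots,d\}$, conjugation $\overline{s}=\sum_A(-1)^{|A|(|A|+1)/2}s_Ae_A$ and modulus $|s|^2=\sum_As_A^2$. Paravectors $s=s_0+s_1e_1+\dots+s_de_d$ form $\mathbb{R}^{d+1}\subseteq\mathbb{R}_d$, $\mathbb{S}$ is the set of paravectors $J$ with $J_0=0$, $|J|=1$, and $\mathbb{C}_J=\{x+Jy\mid x,y\in\mathbb{R}\}$; a set $U\subseteq\mathbb{R}^{d+1}$ is axially symmetric if $s\in U$ implies $s_0+J|s-s_0|\in U$ for all $J\in\mathbb{S}$. For $U$ open and axially symmetric put $\mathcal{U}=\{(x,y)\in\mathbb{R}^2\mid x+\mathbb{S}y\subseteq U\}$. A function $f:U\to\mathbb{R}_d$ is left (right) slice hyperholomorphic, $f\in\mathcal{SH}_L(U)$ ($f\in\mathcal{SH}_R(U)$), if there are $C^1$-functions $f_0,f_1:\mathcal{U}\to\mathbb{R}_d$ with $f(x+Jy)=f_0(x,y)+Jf_1(x,y)$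 (resp. $f_0(x,y)+f_1(x,y)J$) for all $(x,y)\in\mathcal{U}$, $J\in\mathbb{S}$, with $f_0$ even and $f_1$ odd in $y$, and $\partial_xf_0=\partial_yf_1$, $\partial_yf_0=-\partial_xf_1$; it is intrinsic, $f\in\mathcal{N}(U)$, if moreover $f_0,f_1$ are real valued. Put $f^\#(s)=\overline{f(\overline{s})}$. Let $V=V_{\mathbb{R}}\otimes\mathbb{R}_d$ be the Hilbert module over $\mathbb{R}_d$ of a real Hilbert space $V_{\mathbb{R}}$, with real inner product $\operatorname{Sc}\langle v,w\rangle=\sum_A\langle v_A,w_A\rangle_{\mathbb{R}}$; adjoints are taken with respect to it. Let $\mathcal{B}(V)$ be the bounded everywhere defined right-linear operators. For a closed right-linear operator $T$ in $V$ let $Q_s[T]=T^2-2s_0T+|s|^2$ on $\operatorname{dom}(T^2)$, $\rho_S(T)=\{s\in\mathbb{R}^{d+1}\mid Q_s[T]^{-1}\in\mathcal{B}(V)\}$, and, for $s\in\rho_S(T)$, $S_L^{-1}(s,T)=Q_s[T]^{-1}\overline{s}-TQ_s[T]^{-1}$, $S_R^{-1}(s,T)=(\overline{s}-T)Q_s[T]^{-1}$.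 For compact, axially symmetric $K\subseteq\rho_S(T)$ and $f\in\mathcal{SH}_L(\mathbb{R}^{d+1}\setminus K)$ (resp. $\mathcal{SH}_R$) with a limit $f_\infty=\lim_{|s|\to\infty}f(s)\in\mathbb{R}_d$, the unbounded $S$-functional calculus is $$f(T)=f_\infty-\frac1{2\pi}\int_{\partial U\cap\mathbb{C}_J}S_L^{-1}(s,T)\,ds_J\,f(s)\qquad\Big(\text{resp. }f(T)=f_\infty-\frac1{2\pi}\int_{\partial U\cap\mathbb{C}_J}f(s)\,ds_J\,S_R^{-1}(s,T)\Big),$$ where $ds_J=-J\,ds$, $J\in\mathbb{S}$, and $U$ is an axially symmetric open set with $K\subseteq U\subseteq\overline{U}\subseteq\rho_S(T)$ such that the boundary of $U\cap\mathbb{C}_J$ in $\mathbb{C}_J$ consists of finitely many closed piecewise $C^1$ curves, which together have winding number $1$ about the points of $U\cap\mathbb{C}_J$ and $0$ about the points of $\mathbb{C}_J$ outside its closure. **Theorem.** Let $T$ be a densely defined closed right-linear operator in $V$, let $K\subseteq\rho_S(T)$ be compact and axially symmetric, and let $f:\mathbb{R}^{d+1}\setminus K\to\mathbb{R}_d$ have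 a limit in $\mathbb{R}_d$ as $|s|\to\infty$. Then $T^*$ is closed and right-linear, $K\subseteq\rho_S(T^*)$, and $f^\#$ has a limit in $\mathbb{R}_d$ as $|s|\to\infty$. Moreover: 1. If $f\in\mathcal{SH}_L(\mathbb{R}^{d+1}\setminus K)$, then $f^\#\in\mathcal{SH}_R(\mathbb{R}^{d+1}\setminus K)$ and $f(T^*)=f^\#(T)^*$, with the left calculus for $f(T^*)$ and the right calculus for $f^\#(T)$. 2. If $f\in\mathcal{SH}_R(\mathbb{R}^{d+1}\setminus K)$, then $f^\#\in\mathcal{SH}_L(\mathbb{R}^{d+1}\setminus K)$ and $f(T^*)=f^\#(T)^*$, with the right calculus for $f(T^*)$ and the left calculus for $f^\#(T)$. 3. If $f\in\mathcal{N}(\mathbb{R}^{d+1}\setminus K)$, then $f(T^*)=f(T)^*$, where on each side either the left or the right calculus may be used. All these equalities hold for every admissible choice of $J$, $U$ and boundary curves on the left-hand side and every, possibly different, admissible choice on the right-hand side. -/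

import Mathlib

open scoped symmDiff InnerProductSpace

noncomputable section

namespace CliffordSFC

/-! ### The real Clifford algebra -/

/-- The underlying space of the real Clifford algebra `ℝ_d`: the Clifford number
`∑_A s_A e_A` is stored as its family of coefficients `s_A`, where `A` runs over the subsets of
the `d` indices and `e_A` is the product of the units `e_i`, `i ∈ A`, in increasing order.
The Euclidean norm is the absolute value `|s| = (∑_A s_A ^ 2) ^ (1/2)`. -/
abbrev Cl (d : ℕ) : Type := EuclideanSpace ℝ (Finset (Fin d))

/-- The sign in `e_A e_B = sgn A B • e_{A ∆ B}`: every pair `i ∈ A`, `j ∈ B` with `j < i` has to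
be interchanged (one minus sign each), and every common index gives `e_i ^ 2 = -1`. -/
def sgn {d : ℕ} (A B : Finset (Fin d)) : ℝ := ∏ i ∈ A, ∏ j ∈ B, if j ≤ i then -1 else 1

/-- The Hilbert module `V = V_ℝ ⊗ ℝ_d` over a real Hilbert space `H = V_ℝ`: the element
`∑_A v_A ⊗ e_A` is stored as the family `v_A`. Its real inner product is
`∑_A ⟪v_A, w_A⟫`, which is the scalar part of the Clifford valued inner product
`∑_{A, B} ⟪v_A, w_B⟫ conj(e_A) e_B`, and its norm is `(∑_A ‖v_A‖ ^ 2) ^ (1/2)`. -/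
abbrev HMod (d : ℕ) (H : Type*) : Type _ := PiLp 2 (fun _ : Finset (Fin d) => H)

section Multiplication

variable {d : ℕ} {H : Type*} [NormedAddCommGroup H] [InnerProductSpace ℝ H]

/-- Left multiplication `v ↦ s v`, where
`s v = ∑_{A, B} (s_B v_A) ⊗ (e_B e_A)`; the coefficient at `C` collects `A = B ∆ C`. -/
def lmul (s : Cl d) : HMod d H →L[ℝ] HMod d H :=
  ((PiLp.continuousLinearEquiv 2 ℝ (fun _ : Finset (Fin d) => H)).symm :
      (Finset (Fin d) → H) →L[ℝ] HMod d H) ∘L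
    ContinuousLinearMap.pi fun C => ∑ B : Finset (Fin d),
      (s B * sgn B (B ∆ C)) • PiLp.proj (𝕜 := ℝ) 2 (fun _ : Finset (Fin d) => H) (B ∆ C)

/-- Right multiplication `v ↦ v s`, where
`v s = ∑_{A, B} (v_A s_B) ⊗ (e_A e_B)`; the coefficient at `C` collects `A = B ∆ C`. -/
def rmul (s : Cl d) : HMod d H →L[ℝ] HMod d H :=
  ((PiLp.continuousLinearEquiv 2 ℝ (fun _ : Finset (Fin d) => H)).symm :
      (Finset (Fin d) → H) →L[ℝ] HMod d H) ∘L
    ContinuousLinearMap.pi fun C => ∑ B : Finset (Fin d),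
      (s B * sgn (B ∆ C) B) • PiLp.proj (𝕜 := ℝ) 2 (fun _ : Finset (Fin d) => H) (B ∆ C)

theorem lmul_apply (s : Cl d) (v : HMod d H) (C : Finset (Fin d)) :
    lmul s v C = ∑ B : Finset (Fin d), (s B * sgn B (B ∆ C)) • v (B ∆ C) := by
  simp [lmul]

theorem rmul_apply (s : Cl d) (v : HMod d H) (C : Finset (Fin d)) :
    rmul s v C = ∑ B : Finset (Fin d), (s B * sgn (B ∆ C) B) • v (B ∆ C) := by
  simp [rmul]

theorem prod_symmDiff {ι : Type*} [DecidableEq ι] (A B : Finset ι) (g : ι → ℝ)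
    (hg : ∀ i, g i * g i = 1) : ∏ i ∈ A ∆ B, g i = (∏ i ∈ A, g i) * ∏ i ∈ B, g i := by
  have h1 : (∏ i ∈ A \ B, g i) * ∏ i ∈ A ∩ B, g i = ∏ i ∈ A, g i := by
    rw [mul_comm, Finset.prod_inter_mul_prod_sdiff]
  have h2 : (∏ i ∈ B \ A, g i) * ∏ i ∈ A ∩ B, g i = ∏ i ∈ B, g i := by
    rw [mul_comm, Finset.inter_comm, Finset.prod_inter_mul_prod_sdiff]
  have h3 : (∏ i ∈ A ∩ B, g i) * ∏ i ∈ A ∩ B, g i = 1 := by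
    rw [← Finset.prod_mul_distrib]
    exact Finset.prod_eq_one fun i _ => hg i
  have h4 : ∏ i ∈ A ∆ B, g i = (∏ i ∈ A \ B, g i) * ∏ i ∈ B \ A, g i := by
    rw [symmDiff_def, Finset.sup_eq_union, Finset.prod_union]
    exact disjoint_sdiff_sdiff
  rw [h4, ← h1, ← h2]
  linear_combination (-(∏ i ∈ A \ B, g i) * ∏ i ∈ B \ A, g i) * h3

theorem sgn_mul_self (A B : Finset (Fin d)) : sgn A B * sgn A B = 1 := by
  unfold sgn
  rw [← Finset.prod_mul_distrib]
  refine Finset.prod_eq_one fun i _ => ?_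
  rw [← Finset.prod_mul_distrib]
  refine Finset.prod_eq_one fun j _ => ?_
  split_ifs <;> norm_num

theorem sgn_symmDiff_left (A B C : Finset (Fin d)) : sgn (A ∆ B) C = sgn A C * sgn B C := by
  unfold sgn
  refine prod_symmDiff A B _ fun i => ?_
  rw [← Finset.prod_mul_distrib]
  refine Finset.prod_eq_one fun j _ => ?_
  split_ifs <;> norm_num

theorem sgn_symmDiff_right (A B C : Finset (Fin d)) : sgn A (B ∆ C) = sgn A B * sgn A C := by
  unfold sgn
  rw [← Finset.prod_mul_distrib]
  refine Finset.prod_congr rfl fun i _ => prod_symmDiff B C _ fun j => ?_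
  split_ifs <;> norm_num

/-- The product of Clifford numbers, the real-bilinear product with
`e_A e_B = sgn A B • e_{A ∆ B}`. -/
instance instMulCl : Mul (Cl d) := ⟨fun a b => lmul (H := ℝ) a b⟩

/-- The unit `1 = e_∅` of the Clifford algebra. -/
instance instOneCl : One (Cl d) := ⟨EuclideanSpace.single ∅ 1⟩

theorem mul_def (a b : Cl d) : a * b = lmul (H := ℝ) a b := rfl

theorem one_def : (1 : Cl d) = EuclideanSpace.single ∅ 1 := rfl

theorem mul_apply (a b : Cl d) (C : Finset (Fin d)) :
    (a * b) C = ∑ B : Finset (Fin d), a B * sgn B (B ∆ C) * b (B ∆ C) := by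
  rw [mul_def, lmul_apply]; rfl

theorem lmul_add (a b : Cl d) : lmul (H := H) (a + b) = lmul a + lmul b := by
  ext v C
  simp [lmul_apply, add_mul, add_smul, Finset.sum_add_distrib]

theorem lmul_smul (r : ℝ) (a : Cl d) : lmul (H := H) (r • a) = r • lmul a := by
  ext v C
  simp [lmul_apply, mul_assoc, mul_smul, Finset.smul_sum]

theorem lmul_one : lmul (H := H) (1 : Cl d) = ContinuousLinearMap.id ℝ (HMod d H) := by
  ext v C
  rw [lmul_apply, Finset.sum_eq_single ∅]
  · rw [show (∅ : Finset (Fin d)) ∆ C = C from bot_symmDiff C]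
    simp [one_def, sgn]
  · intro B _ hB
    simp [one_def, hB]
  · simp

theorem lmul_mul (a b : Cl d) : lmul (H := H) (a * b) = lmul a ∘L lmul b := by
  ext v C
  simp only [ContinuousLinearMap.comp_apply, lmul_apply, mul_apply, Finset.sum_mul,
    Finset.sum_smul, Finset.smul_sum]
  rw [Finset.sum_comm]
  refine Finset.sum_congr rfl fun A _ => ?_
  refine Finset.sum_bij' (fun D _ => A ∆ D) (fun D _ => A ∆ D) (by simp) (by simp)
    (fun D _ => symmDiff_symmDiff_cancel_left A D) (fun D _ => symmDiff_symmDiff_cancel_left A D)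
    fun D _ => ?_
  have h1 : (A ∆ D) ∆ (A ∆ C) = D ∆ C := by
    rw [symmDiff_comm A D, symmDiff_assoc, symmDiff_symmDiff_cancel_left]
  rw [h1, smul_smul]
  congr 1
  rw [sgn_symmDiff_left A D (D ∆ C), sgn_symmDiff_right A D C, sgn_symmDiff_right A A D,
    sgn_symmDiff_right A A C]
  linear_combination (-(a A * b (A ∆ D) * sgn D (D ∆ C) * sgn A A * sgn A D)) *
    sgn_mul_self A C

/-- The real Clifford algebra `ℝ_d` is a ring. -/
instance instRingCl : Ring (Cl d) where
  __ := (inferInstance : AddCommGroup (Cl d))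
  mul_assoc a b c := by rw [mul_def (a * b), lmul_mul]; rfl
  one_mul a := by rw [mul_def, lmul_one]; rfl
  mul_one a := by
    ext C
    rw [mul_apply, Finset.sum_eq_single C]
    · simp [one_def, sgn]
    · intro B _ hB
      have : B ∆ C ≠ ∅ := fun h => hB (symmDiff_eq_bot.1 h)
      simp [one_def, this]
    · simp
  zero_mul a := by ext C; simp [mul_apply]
  mul_zero a := by ext C; simp [mul_apply]
  left_distrib a b c := by simp only [mul_def, map_add]
  right_distrib a b c := by simp only [mul_def, lmul_add]; rfl

/-- The real Clifford algebra `ℝ_d` is a real algebra. -/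
instance instAlgebraCl : Algebra ℝ (Cl d) :=
  Algebra.ofModule (fun r a b => by simp only [mul_def, lmul_smul]; rfl)
    (fun r a b => by simp only [mul_def, map_smul])

theorem single_mul_single (A B : Finset (Fin d)) (a b : ℝ) :
    (EuclideanSpace.single A a : Cl d) * EuclideanSpace.single B b =
      EuclideanSpace.single (A ∆ B) (a * b * sgn A B) := by
  ext C
  rw [mul_apply, Finset.sum_eq_single A]
  · by_cases h : C = A ∆ B
    · subst h
      simp
      ring
    · have : A ∆ C ≠ B := fun h' => h (by rw [← h', symmDiff_symmDiff_cancel_left])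
      simp [h, this]
  · intro D _ hD
    simp [hD]
  · simp

/-- The imaginary unit `e_i`. -/
def unit (i : Fin d) : Cl d := EuclideanSpace.single {i} 1

theorem unit_mul_add_unit_mul (i j : Fin d) :
    unit i * unit j + unit j * unit i = if i = j then (-2 : ℝ) • (1 : Cl d) else 0 := by
  unfold unit
  rw [single_mul_single, single_mul_single, symmDiff_comm ({j} : Finset (Fin d)) {i}]
  split_ifs with h
  · subst h
    ext C
    simp [sgn, one_def]
    split_ifs <;> norm_num
  · ext C
    rcases lt_or_gt_of_ne h with h | h <;> simp [sgn, h.le, h.not_ge] <;> split_ifs <;> norm_num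

/-- The quadratic form `-(x_1 ^ 2 + ... + x_d ^ 2)`. -/
def negSq (d : ℕ) : QuadraticForm ℝ (Fin d → ℝ) :=
  QuadraticMap.weightedSumSquares ℝ (fun _ : Fin d => (-1 : ℝ))

/-- The linear map `x ↦ x_1 e_1 + ... + x_d e_d`. -/
def vec (d : ℕ) : (Fin d → ℝ) →ₗ[ℝ] Cl d := ∑ i, (LinearMap.proj i).smulRight (unit i)

theorem vec_apply (x : Fin d → ℝ) : vec d x = ∑ i, x i • unit i := by simp [vec]

theorem vec_mul_vec (x : Fin d → ℝ) : vec d x * vec d x = algebraMap ℝ (Cl d) (negSq d x) := by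
  have h1 : vec d x * vec d x = ∑ i, ∑ j, (x i * x j) • (unit i * unit j : Cl d) := by
    rw [vec_apply, Finset.sum_mul_sum]
    simp only [smul_mul_smul_comm]
  have h2 : vec d x * vec d x = ∑ i, ∑ j, (x i * x j) • (unit j * unit i : Cl d) := by
    rw [h1, Finset.sum_comm]
    simp only [mul_comm]
  have h3 : (2 : ℝ) • (vec d x * vec d x) = (2 : ℝ) • algebraMap ℝ (Cl d) (negSq d x) := by
    rw [two_smul]
    nth_rw 1 [h1]
    rw [h2, ← Finset.sum_add_distrib]
    simp only [← Finset.sum_add_distrib, ← smul_add, unit_mul_add_unit_mul]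
    simp [negSq, QuadraticMap.weightedSumSquares_apply, Algebra.algebraMap_eq_smul_one,
      smul_smul, ← Finset.sum_smul, ← Finset.sum_mul]
    ring
  exact smul_right_injective _ (two_ne_zero' ℝ) h3

/-- The canonical homomorphism from Mathlib's Clifford algebra. -/
def ofCliffordAlgebra (d : ℕ) : CliffordAlgebra (negSq d) →ₐ[ℝ] Cl d :=
  CliffordAlgebra.lift (negSq d) ⟨vec d, vec_mul_vec⟩

theorem single_mem_range (A : Finset (Fin d)) :
    (EuclideanSpace.single A 1 : Cl d) ∈ (ofCliffordAlgebra d).range := by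
  induction A using Finset.induction_on with
  | empty => exact one_mem _
  | insert i A hi ih =>
    have hu : unit i ∈ (ofCliffordAlgebra d).range :=
      ⟨CliffordAlgebra.ι _ (Pi.single i 1), by
        simp [ofCliffordAlgebra, vec_apply, Pi.single_apply]⟩
    have h1 : ({i} : Finset (Fin d)) ∆ A = insert i A := by
      rw [Disjoint.symmDiff_eq_sup (by simpa using hi)]; rfl
    have h2 : (EuclideanSpace.single (insert i A) 1 : Cl d) =
        sgn {i} A • (unit i * EuclideanSpace.single A 1) := by
      rw [unit, single_mul_single, h1]
      ext C
      simp [sgn_mul_self]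
    rw [h2]
    exact Subalgebra.smul_mem _ (mul_mem hu ih) _

/-- The algebra `Cl d` is Mathlib's Clifford algebra of `-(x_1 ^ 2 + ... + x_d ^ 2)`. -/
theorem ofCliffordAlgebra_bijective (d : ℕ) : Function.Bijective (ofCliffordAlgebra d) := by
  have hs : Function.Surjective (ofCliffordAlgebra d) := by
    intro a
    have : a = ∑ A, a A • (EuclideanSpace.single A 1 : Cl d) := by
      ext C
      simp [Pi.single_apply]
    change a ∈ (ofCliffordAlgebra d).range
    rw [this]
    exact sum_mem fun A _ => Subalgebra.smul_mem _ (single_mem_range A) _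
  let b := (Pi.basisFun ℝ (Fin d)).ExteriorAlgebra.map (CliffordAlgebra.equivExterior (negSq d)).symm
  have hf : Module.Finite ℝ (CliffordAlgebra (negSq d)) := Module.Finite.of_basis b
  have hd : Module.finrank ℝ (CliffordAlgebra (negSq d)) = Module.finrank ℝ (Cl d) := by
    rw [Module.finrank_eq_card_basis b, finrank_euclideanSpace]
  exact ⟨(LinearMap.injective_iff_surjective_of_finrank_eq_finrank
    (f := (ofCliffordAlgebra d).toLinearMap) hd).2 hs, hs⟩

end Multiplication

/-! ### Conjugation, paravectors and axially symmetric sets -/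

section Paravectors

variable {d : ℕ}

/-- The conjugate `∑_A (-1) ^ (|A| (|A| + 1) / 2) s_A e_A` of `s = ∑_A s_A e_A`. -/
def conj (s : Cl d) : Cl d :=
  WithLp.toLp 2 fun A => (-1) ^ (A.card * (A.card + 1) / 2) * s A

/-- The space `ℝ^{d+1}` of paravectors `s_0 + s_1 e_1 + ... + s_d e_d`. -/
def Paravector (d : ℕ) : Submodule ℝ (Cl d) where
  carrier := {s | ∀ A : Finset (Fin d), 1 < A.card → s A = 0}
  add_mem' := fun ha hb A hA => by simp [ha A hA, hb A hA]
  zero_mem' := fun A _ => rfl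
  smul_mem' := fun r a ha A hA => by simp [ha A hA]

theorem conj_mem (s : Paravector d) : conj (s : Cl d) ∈ Paravector d := fun A hA => by
  simp [conj, s.2 A hA]

/-- The conjugate of a paravector. -/
def pconj (s : Paravector d) : Paravector d := ⟨conj (s : Cl d), conj_mem s⟩

/-- The real part `s_0` of a paravector. -/
def re (s : Paravector d) : ℝ := (s : Cl d) ∅

theorem one_mem_paravector : (1 : Cl d) ∈ Paravector d := fun A hA => by
  have : A ≠ ∅ := fun h => by simp [h] at hA
  simp [one_def, this]

/-- The real number `x` as a paravector. -/
def ofReal (x : ℝ) : Paravector d := x • ⟨1, one_mem_paravector⟩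

/-- The imaginary part `s_1 e_1 + ... + s_d e_d` of a paravector. -/
def im (s : Paravector d) : Paravector d := s - ofReal (re s)

/-- The sphere `𝕊` of imaginary units. -/
def imUnits (d : ℕ) : Set (Paravector d) := {J | re J = 0 ∧ ‖J‖ = 1}

/-- The point `x + J y` of the plane `ℂ_J`, where the pair `(x, y)` is written as the complex
number `z = x + i y`. -/
def slicePt (J : Paravector d) (z : ℂ) : Paravector d := ofReal z.re + z.im • J

/-- A set is axially symmetric if it contains with `s` the sphere `[s] = s_0 + 𝕊 |Im s|`. -/
def AxiallySymmetric (U : Set (Paravector d)) : Prop :=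
  ∀ s ∈ U, ∀ J ∈ imUnits d, ofReal (re s) + ‖im s‖ • J ∈ U

/-! ### Slice hyperholomorphic functions -/

/-- The set of all `(x, y)` with `x + 𝕊 y ⊆ U`. -/
def profile (U : Set (Paravector d)) : Set ℂ := {z | ∀ J ∈ imUnits d, slicePt J z ∈ U}

/-- `f_0, f_1` are continuously differentiable on the domain `D` in the `(x, y)`-plane, satisfy
the compatibility conditions (even, respectively odd, in `y`) and the Cauchy-Riemann equations.
Here `fderiv ℝ f z 1 = ∂f/∂x` and `fderiv ℝ f z Complex.I = ∂f/∂y`. -/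
structure IsSlicePair (f₀ f₁ : ℂ → Cl d) (D : Set ℂ) : Prop where
  contDiff₀ : ContDiffOn ℝ 1 f₀ D
  contDiff₁ : ContDiffOn ℝ 1 f₁ D
  even : ∀ z ∈ D, f₀ (starRingEnd ℂ z) = f₀ z
  odd : ∀ z ∈ D, f₁ (starRingEnd ℂ z) = -f₁ z
  cauchyRiemann₁ : ∀ z ∈ D, fderiv ℝ f₀ z 1 = fderiv ℝ f₁ z Complex.I
  cauchyRiemann₂ : ∀ z ∈ D, fderiv ℝ f₀ z Complex.I = -fderiv ℝ f₁ z 1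

/-- Left slice hyperholomorphic functions on (an open, axially symmetric set) `U`. -/
def LeftSlice (f : Paravector d → Cl d) (U : Set (Paravector d)) : Prop :=
  ∃ f₀ f₁ : ℂ → Cl d, IsSlicePair f₀ f₁ (profile U) ∧
    ∀ z ∈ profile U, ∀ J ∈ imUnits d, f (slicePt J z) = f₀ z + (J : Cl d) * f₁ z

/-- Right slice hyperholomorphic functions on (an open, axially symmetric set) `U`. -/
def RightSlice (f : Paravector d → Cl d) (U : Set (Paravector d)) : Prop :=
  ∃ f₀ f₁ : ℂ → Cl d, IsSlicePair f₀ f₁ (profile U) ∧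
    ∀ z ∈ profile U, ∀ J ∈ imUnits d, f (slicePt J z) = f₀ z + f₁ z * (J : Cl d)

/-- Intrinsic functions on (an open, axially symmetric set) `U`: slice hyperholomorphic functions
with real valued components `f_0, f_1`. -/
def Intrinsic (f : Paravector d → Cl d) (U : Set (Paravector d)) : Prop :=
  ∃ f₀ f₁ : ℂ → Cl d, IsSlicePair f₀ f₁ (profile U) ∧
    (∀ z ∈ profile U, (∃ r : ℝ, f₀ z = algebraMap ℝ (Cl d) r) ∧
      ∃ r : ℝ, f₁ z = algebraMap ℝ (Cl d) r) ∧
    ∀ z ∈ profile U, ∀ J ∈ imUnits d, f (slicePt J z) = f₀ z + (J : Cl d) * f₁ z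

/-- The function `f^#(s) = conj (f (conj s))`. -/
def sharp (f : Paravector d → Cl d) (s : Paravector d) : Cl d := conj (f (pconj s))

end Paravectors

/-! ### Closed operators and the S-resolvents -/

section Operators

variable {d : ℕ} {H : Type*} [NormedAddCommGroup H] [InnerProductSpace ℝ H]

/-- A (possibly unbounded) operator is right-linear if its domain is invariant under right
multiplication and `T (v a) = (T v) a`. -/
def IsRightLinear (T : HMod d H →ₗ.[ℝ] HMod d H) : Prop :=
  ∀ (v : T.domain) (a : Cl d), ∃ h : rmul a (v : HMod d H) ∈ T.domain,
    T ⟨rmul a (v : HMod d H), h⟩ = rmul a (T v)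

/-- The class of closed right-linear operators. -/
def IsClosedRightLinear (T : HMod d H →ₗ.[ℝ] HMod d H) : Prop :=
  IsRightLinear T ∧ T.IsClosed

/-- The domain `{v ∈ dom T | T v ∈ dom T}` of `T ^ 2`. -/
def domSq (T : HMod d H →ₗ.[ℝ] HMod d H) : Submodule ℝ (HMod d H) :=
  (T.domain.comap T.toFun).map T.domain.subtype

theorem mem_domSq {T : HMod d H →ₗ.[ℝ] HMod d H} {v : HMod d H} :
    v ∈ domSq T ↔ ∃ h : v ∈ T.domain, T ⟨v, h⟩ ∈ T.domain := by
  simp [domSq]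

/-- The operator `Q_s[T] = T ^ 2 - 2 s_0 T + |s| ^ 2` with domain `dom (T ^ 2)`. -/
def Qop (T : HMod d H →ₗ.[ℝ] HMod d H) (s : Paravector d) : HMod d H →ₗ.[ℝ] HMod d H where
  domain := domSq T
  toFun :=
    { toFun := fun v =>
        T ⟨T ⟨v, (mem_domSq.1 v.2).1⟩, (mem_domSq.1 v.2).2⟩
          - (2 * re s) • T ⟨v, (mem_domSq.1 v.2).1⟩ + (‖s‖ ^ 2) • (v : HMod d H)
      map_add' := fun v w => by
        have hv := mem_domSq.1 v.2
        have hw := mem_domSq.1 w.2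
        have h1 : T ⟨(v + w : domSq T), (mem_domSq.1 (v + w).2).1⟩ =
            T ⟨v, hv.1⟩ + T ⟨w, hw.1⟩ := T.map_add ⟨v, hv.1⟩ ⟨w, hw.1⟩
        have h2 : T ⟨T ⟨(v + w : domSq T), (mem_domSq.1 (v + w).2).1⟩,
            (mem_domSq.1 (v + w).2).2⟩ = T ⟨T ⟨v, hv.1⟩, hv.2⟩ + T ⟨T ⟨w, hw.1⟩, hw.2⟩ := by
          rw [← T.map_add]
          congr 1
          exact Subtype.ext h1
        rw [h2, h1, Submodule.coe_add, smul_add, smul_add]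
        abel
      map_smul' := fun r v => by
        have hv := mem_domSq.1 v.2
        have h1 : T ⟨(r • v : domSq T), (mem_domSq.1 (r • v).2).1⟩ = r • T ⟨v, hv.1⟩ :=
          T.map_smul r ⟨v, hv.1⟩
        have h2 : T ⟨T ⟨(r • v : domSq T), (mem_domSq.1 (r • v).2).1⟩,
            (mem_domSq.1 (r • v).2).2⟩ = r • T ⟨T ⟨v, hv.1⟩, hv.2⟩ := by
          rw [← T.map_smul]
          congr 1
          exact Subtype.ext h1
        rw [h2, h1, Submodule.coe_smul, RingHom.id_apply, smul_add, smul_sub,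
          smul_comm r (2 * re s), smul_comm r (‖s‖ ^ 2)] }

/-- `R` is a bounded, everywhere defined, right-linear operator and `R = Q_s[T]⁻¹`. -/
structure IsPseudoResolvent (T : HMod d H →ₗ.[ℝ] HMod d H) (s : Paravector d)
    (R : HMod d H →L[ℝ] HMod d H) : Prop where
  rightLinear : ∀ v a, R (rmul a v) = rmul a (R v)
  right_inv : ∀ v, ∃ h : R v ∈ (Qop T s).domain, Qop T s ⟨R v, h⟩ = v
  left_inv : ∀ v : (Qop T s).domain, R (Qop T s v) = v

theorem IsPseudoResolvent.unique {T : HMod d H →ₗ.[ℝ] HMod d H} {s : Paravector d}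
    {R R' : HMod d H →L[ℝ] HMod d H} (h : IsPseudoResolvent T s R)
    (h' : IsPseudoResolvent T s R') : R = R' := by
  ext1 v
  obtain ⟨hv, e⟩ := h'.right_inv v
  conv_lhs => rw [← e]
  exact h.left_inv ⟨R' v, hv⟩

/-- The S-resolvent set: all paravectors `s` such that `Q_s[T]⁻¹` is a bounded, everywhere defined
right-linear operator. -/
def rhoS (T : HMod d H →ₗ.[ℝ] HMod d H) : Set (Paravector d) :=
  {s | ∃ R, IsPseudoResolvent T s R}

open Classical in
/-- The bounded operator `Q_s[T]⁻¹`, for `s` in the S-resolvent set. -/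
def Qinv (T : HMod d H →ₗ.[ℝ] HMod d H) (s : Paravector d) : HMod d H →L[ℝ] HMod d H :=
  if h : ∃ R, IsPseudoResolvent T s R then h.choose else 0

theorem Qinv_spec {T : HMod d H →ₗ.[ℝ] HMod d H} {s : Paravector d} (hs : s ∈ rhoS T) :
    IsPseudoResolvent T s (Qinv T s) := by
  have h : ∃ R, IsPseudoResolvent T s R := hs
  rw [Qinv, dif_pos h]
  exact h.choose_spec

open Classical in
/-- The operator `T Q_s[T]⁻¹`, for `s` in the S-resolvent set; it is everywhere defined, and
bounded if `T` is closed. -/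
def TQinv (T : HMod d H →ₗ.[ℝ] HMod d H) (s : Paravector d) : HMod d H →L[ℝ] HMod d H :=
  if h : ∃ B : HMod d H →L[ℝ] HMod d H,
      ∀ v, ∃ hv : Qinv T s v ∈ T.domain, B v = T ⟨Qinv T s v, hv⟩
    then h.choose else 0

/-- For closed `T` and `s` in the S-resolvent set, `TQinv` really is `T Q_s[T]⁻¹`. -/
theorem TQinv_spec [CompleteSpace H] {T : HMod d H →ₗ.[ℝ] HMod d H} (hT : T.IsClosed)
    {s : Paravector d} (hs : s ∈ rhoS T) (v : HMod d H) :
    ∃ hv : Qinv T s v ∈ T.domain, TQinv T s v = T ⟨Qinv T s v, hv⟩ := by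
  have hdom : ∀ v, Qinv T s v ∈ T.domain := fun v =>
    (mem_domSq.1 ((Qinv_spec hs).right_inv v).1).1
  let B : HMod d H →ₗ[ℝ] HMod d H :=
    T.toFun ∘ₗ (Qinv T s : HMod d H →ₗ[ℝ] HMod d H).codRestrict T.domain hdom
  have hB : ∀ v, B v = T ⟨Qinv T s v, hdom v⟩ := fun v => rfl
  have hgraph : (B.graph : Set (HMod d H × HMod d H)) =
      (fun p : HMod d H × HMod d H => (Qinv T s p.1, p.2)) ⁻¹' (T.graph : Set _) := by
    ext ⟨x, y⟩
    simp only [SetLike.mem_coe, LinearMap.mem_graph_iff, Set.mem_preimage,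
      LinearPMap.mem_graph_iff]
    constructor
    · intro h
      exact ⟨⟨Qinv T s x, hdom x⟩, rfl, h.symm⟩
    · rintro ⟨z, hz, h⟩
      rw [hB]
      have h0 : z = ⟨Qinv T s x, hdom x⟩ := Subtype.ext hz
      rw [← h0]
      exact h.symm
  have hclosed : IsClosed (B.graph : Set (HMod d H × HMod d H)) := by
    rw [hgraph]
    exact IsClosed.preimage (by fun_prop) hT
  have h : ∃ B : HMod d H →L[ℝ] HMod d H,
      ∀ v, ∃ hv : Qinv T s v ∈ T.domain, B v = T ⟨Qinv T s v, hv⟩ :=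
    ⟨ContinuousLinearMap.ofIsClosedGraph hclosed, fun v => ⟨hdom v, rfl⟩⟩
  rw [TQinv, dif_pos h]
  exact h.choose_spec v

/-- The left S-resolvent `S_L⁻¹(s, T) = Q_s[T]⁻¹ conj(s) - T Q_s[T]⁻¹`. -/
def SL (T : HMod d H →ₗ.[ℝ] HMod d H) (s : Paravector d) : HMod d H →L[ℝ] HMod d H :=
  Qinv T s ∘L lmul (conj (s : Cl d)) - TQinv T s

/-- The right S-resolvent `S_R⁻¹(s, T) = (conj(s) - T) Q_s[T]⁻¹`. -/
def SR (T : HMod d H →ₗ.[ℝ] HMod d H) (s : Paravector d) : HMod d H →L[ℝ] HMod d H :=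
  lmul (conj (s : Cl d)) ∘L Qinv T s - TQinv T s

/-! ### The unbounded S-functional calculus -/

/-- A closed, piecewise continuously differentiable curve with parameter interval `[0, 1]`: the
interval is cut by finitely many points `P` into closed pieces on each of which the curve is
continuously differentiable up to the end points. -/
structure IsClosedCurve (γ : ℝ → ℂ) : Prop where
  closed : γ 0 = γ 1
  continuousOn : ContinuousOn γ (Set.Icc 0 1)
  piecewise : ∃ P : Finset ℝ, ∀ a b : ℝ, 0 ≤ a → a < b → b ≤ 1 →
    Disjoint (Set.Ioo a b) (P : Set ℝ) → ContDiffOn ℝ 1 γ (Set.Icc a b)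

/-- The winding number of a closed curve about a point `z` not on the curve. -/
def windingNumber (γ : ℝ → ℂ) (z : ℂ) : ℂ :=
  (2 * Real.pi * Complex.I)⁻¹ * ∫ t in (0 : ℝ)..1, deriv γ t / (γ t - z)

/-- The finitely many closed curves `γ_k` form the positively oriented boundary of the plane open
set `D`: together they run through the boundary of `D`, they wind once around every point of `D`
and do not wind around the points outside the closure of `D`. -/
structure IsPositiveBoundary {n : ℕ} (γ : Fin n → ℝ → ℂ) (D : Set ℂ) : Prop where
  curve : ∀ k, IsClosedCurve (γ k)
  frontier_eq : frontier D = ⋃ k, γ k '' Set.Icc 0 1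
  inside : ∀ z ∈ D, ∑ k, windingNumber (γ k) z = 1
  outside : ∀ z ∉ closure D, ∑ k, windingNumber (γ k) z = 0

/-- The admissible choices in the integral of the unbounded S-functional calculus of `T` for
functions on the complement of `K`: an imaginary unit `J` and an axially symmetric open set `U`
with `K ⊆ U` and `closure U ⊆ ρ_S(T)`, such that the boundary of `U ∩ ℂ_J` in the plane `ℂ_J`
consists of finitely many closed, piecewise continuously differentiable curves. -/
structure Contour (T : HMod d H →ₗ.[ℝ] HMod d H) (K : Set (Paravector d)) where
  J : Paravector d
  J_mem : J ∈ imUnits d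
  U : Set (Paravector d)
  isOpen_U : IsOpen U
  symm_U : AxiallySymmetric U
  subset_U : K ⊆ U
  closure_U : closure U ⊆ rhoS T
  n : ℕ
  γ : Fin n → ℝ → ℂ
  boundary : IsPositiveBoundary γ {z | slicePt J z ∈ U}

variable {T : HMod d H →ₗ.[ℝ] HMod d H} {K : Set (Paravector d)}

/-- The point `s(t)` of the `k`-th boundary curve in `ℂ_J`. -/
def Contour.pt (C : Contour T K) (k : Fin C.n) (t : ℝ) : Paravector d := slicePt C.J (C.γ k t)

/-- The density of `ds_J = -J ds` along the `k`-th boundary curve, i.e. `-J s'(t)`. -/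
def Contour.dsJ (C : Contour T K) (k : Fin C.n) (t : ℝ) : Cl d :=
  -(C.J : Cl d) * (slicePt C.J (deriv (C.γ k) t) : Cl d)

/-- The value `f_∞` of `f` at infinity. -/
def atInfinity (f : Paravector d → Cl d) : Cl d := Filter.limUnder (Bornology.cobounded (Paravector d)) f

/-- The unbounded S-functional calculus for left slice hyperholomorphic functions,
`f(T) = f_∞ - (2π)⁻¹ ∫ S_L⁻¹(s, T) ds_J f(s)`. -/
def leftCalc (f : Paravector d → Cl d) (C : Contour T K) : HMod d H →L[ℝ] HMod d H :=
  lmul (atInfinity f) - (2 * Real.pi)⁻¹ • ∑ k, ∫ t in (0 : ℝ)..1,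
    SL T (C.pt k t) ∘L lmul (C.dsJ k t) ∘L lmul (f (C.pt k t))

/-- The unbounded S-functional calculus for right slice hyperholomorphic functions,
`f(T) = f_∞ - (2π)⁻¹ ∫ f(s) ds_J S_R⁻¹(s, T)`. -/
def rightCalc (f : Paravector d → Cl d) (C : Contour T K) : HMod d H →L[ℝ] HMod d H :=
  lmul (atInfinity f) - (2 * Real.pi)⁻¹ • ∑ k, ∫ t in (0 : ℝ)..1,
    lmul (f (C.pt k t)) ∘L lmul (C.dsJ k t) ∘L SR T (C.pt k t)

end Operators

end CliffordSFC

end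

/-! Paired with two vectors, the functional calculus becomes a finite sum of scalar complex contour
integrals from which the imaginary unit J has disappeared; passing to the adjoint only interchanges
the two vectors.

For s = x + Jy in the S-resolvent set put z = x + iy, R = Q_s[T]⁻¹ and A = TR. These operators
depend only on x and |z|², not on J. The function ⟪(x - T)Rv, w⟫ - iy⟪Rv, w⟫, called
`resolventForm`, plays the role of a matrix coefficient of -(T - z)⁻¹. It is holomorphic
(`differentiableAt_resolventForm`) and commutes with complex conjugation of z
(`resolventForm_conj`). Since (R*, A*) is the corresponding pair for T* (`IsResolventPair.adjoint`),
its value for T* at (v, w) is its value for T at (w, v) (`resolventForm_adjoint`).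

A slice function splits into the holomorphic functions F_A = (f_0)_A + i (f_1)_A, which also commute
with conjugation. Left multiplication by J acts as an imaginary unit, so the paired integrands are
sums over A of Re(F_A · form · (-i dz)) and of Im of the same expression with J (or its conjugate)
applied to one vector. The boundary is symmetric about the real axis up to homology, so the total
integrals are real (`Contour.form_im`) and the second kind of term vanishes. This gives
`inner_leftCalc` and `inner_rightCalc`.

Independence of contour and plane (`Contour.form_eq`) is the homological Cauchy theorem
`sum_curveInt_eq_zero`, proved by Dixon's method. It is what permits unrelated contours on the two
sides.

What remains is bookkeeping. Passing from f to f^# moves J to the other side and multiplies F_A by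
the sign in conj(e_A) = ± e_A; the adjoint of multiplication by e_A is multiplication by conj(e_A),
and the signs cancel (`leftCalc_adjoint`, `rightCalc_adjoint`). For intrinsic f only F_∅ survives,
so the left and right calculus agree, and f^# = f off K. -/

/-! ### Integrals along curves and Cauchy's theorem. -/

open MeasureTheory Filter Topology Set Metric in
/-- A dominated integral of functions that are holomorphic in a parameter is holomorphic. -/
theorem differentiableOn_integral_of_locally_dominated {α : Type*} [MeasurableSpace α]
    {μ : Measure α} {F : ℂ → α → ℂ} {U : Set ℂ} (hU : IsOpen U)
    (hmeas : ∀ z ∈ U, AEStronglyMeasurable (F z) μ)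
    (hdiff : ∀ᵐ a ∂μ, DifferentiableOn ℂ (F · a) U)
    (hbound : ∀ z ∈ U, ∃ r > 0, ∃ b : α → ℝ, Integrable b μ ∧
      ∀ᵐ a ∂μ, ∀ w ∈ ball z r, ‖F w a‖ ≤ b a) :
    DifferentiableOn ℂ (fun z => ∫ a, F z a ∂μ) U := by
  intro z₀ hz₀
  obtain ⟨r₁, hr₁, b, hb, hFb⟩ := hbound z₀ hz₀
  obtain ⟨r₂, hr₂, hrU⟩ := Metric.isOpen_iff.1 hU z₀ hz₀
  set r := min r₁ r₂ with hr
  have hr0 : 0 < r := lt_min hr₁ hr₂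
  have hball : ball z₀ r ⊆ U := (ball_subset_ball (min_le_right _ _)).trans hrU
  have hd : ∀ᵐ a ∂μ, ∀ x ∈ U, HasDerivAt (F · a) (deriv (F · a) x) x := by
    filter_upwards [hdiff] with a ha x hx
    exact (ha.differentiableAt (hU.mem_nhds hx)).hasDerivAt
  refine (hasDerivAt_integral_of_dominated_loc_of_deriv_le (F := F)
    (F' := fun x a => deriv (F · a) x) (bound := fun a => b a / (r / 3))
    (s := ball z₀ (r / 3)) (ball_mem_nhds _ (by positivity)) ?_ ?_ ?_ ?_ ?_
    ?_).2.differentiableAt.differentiableWithinAt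
  · filter_upwards [hU.mem_nhds hz₀] with x hx using hmeas x hx
  · refine hb.mono' (hmeas z₀ hz₀) ?_
    filter_upwards [hFb] with a ha using ha z₀ (mem_ball_self hr₁)
  -- Measurability of the derivative: it is a pointwise limit of difference quotients along the
  -- steps `e n`, small enough to keep `z₀ + e n` in the ball of radius `r`.
  · let e : ℕ → ℂ := fun n => ((r / 2 / (n + 1) : ℝ) : ℂ)
    have he0 : ∀ n, e n ≠ 0 := fun n => by
      simp only [e, Complex.ofReal_ne_zero]; positivity
    have heU : ∀ n, z₀ + e n ∈ U := fun n => hball (by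
      have h0 : (0 : ℝ) ≤ r / 2 / (n + 1) := by positivity
      rw [mem_ball, dist_eq_norm, add_sub_cancel_left, Complex.norm_real, Real.norm_of_nonneg h0]
      have : r / 2 / ((n : ℝ) + 1) ≤ r / 2 := div_le_self (by positivity) (by simp)
      linarith)
    have hlim : Tendsto e atTop (𝓝[≠] 0) := by
      refine tendsto_nhdsWithin_iff.2 ⟨?_, Eventually.of_forall he0⟩
      have h1 : Tendsto (fun n : ℕ => r / 2 / ((n : ℝ) + 1)) atTop (𝓝 0) :=
        tendsto_const_div_atTop_nhds_zero_nat (r / 2) |>.comp (tendsto_add_atTop_nat 1) |>.congr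
          fun n => by simp
      exact (Complex.continuous_ofReal.tendsto' 0 0 Complex.ofReal_zero).comp h1
    refine aestronglyMeasurable_of_tendsto_ae (u := atTop)
      (f := fun n a => (e n)⁻¹ • (F (z₀ + e n) a - F z₀ a)) ?_ ?_
    · intro n
      exact ((hmeas _ (heU n)).sub (hmeas _ hz₀)).const_smul (e n)⁻¹
    · filter_upwards [hd] with a ha
      exact (hasDerivAt_iff_tendsto_slope_zero.1 (ha z₀ hz₀)).comp hlim
  -- Cauchy's estimate on the circle of radius `r / 3` about `x`; as `x` is within `r / 3` of `z₀`,
  -- this circle stays in the ball where `b` dominates.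
  · filter_upwards [hFb, hdiff] with a ha hda x hx
    have hsub : closedBall x (r / 3) ⊆ ball z₀ r := by
      intro y hy
      rw [mem_closedBall] at hy
      rw [mem_ball] at hx ⊢
      linarith [dist_triangle y x z₀]
    refine Complex.norm_deriv_le_of_forall_mem_sphere_norm_le (by positivity) ?_ ?_
    · exact (hda.mono (hsub.trans hball)).diffContOnCl_ball subset_rfl
    · intro y hy
      exact ha y (ball_subset_ball (min_le_left _ _) (hsub (sphere_subset_closedBall hy)))
  · exact hb.div_const _
  · filter_upwards [hd] with a ha x hx
    exact ha x (hball (ball_subset_ball (by linarith) hx))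

namespace CliffordSFC

open MeasureTheory Filter Topology Set Metric

/-- Inside a smooth piece `deriv γ` agrees with the derivative within the closed piece, which is
continuous, and the end points are a null set. Every parameter has a neighbourhood free of other
break points, so local integrability on the compact interval suffices. -/
theorem IsClosedCurve.intervalIntegrable_deriv {γ : ℝ → ℂ} (h : IsClosedCurve γ) :
    IntervalIntegrable (deriv γ) volume 0 1 := by
  obtain ⟨P, hP⟩ := h.piecewise
  have hpiece : ∀ a b : ℝ, 0 ≤ a → a < b → b ≤ 1 → Disjoint (Ioo a b) (P : Set ℝ) →
      IntegrableOn (deriv γ) (Icc a b) := by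
    intro a b ha hab hb hd
    have hc := hP a b ha hab hb hd
    have h1 : IntegrableOn (derivWithin γ (Icc a b)) (Icc a b) :=
      (hc.continuousOn_derivWithin (uniqueDiffOn_Icc hab) le_rfl).integrableOn_Icc
    rw [integrableOn_Icc_iff_integrableOn_Ioo] at h1 ⊢
    refine h1.congr_fun (fun t ht => ?_) measurableSet_Ioo
    exact derivWithin_of_mem_nhds (Icc_mem_nhds ht.1 ht.2)
  rw [intervalIntegrable_iff_integrableOn_Icc_of_le zero_le_one]
  refine LocallyIntegrableOn.integrableOn_isCompact (fun x hx => ?_) isCompact_Icc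
  have hcl : IsClosed ((P : Set ℝ) \ {x}) := (P.finite_toSet.sdiff).isClosed
  obtain ⟨ε, hε, hεP⟩ := Metric.isOpen_iff.1 hcl.isOpen_compl x (by simp)
  have hP' : ∀ a b : ℝ, x - ε ≤ a → b ≤ x + ε → (b ≤ x ∨ x ≤ a) →
      Disjoint (Ioo a b) (P : Set ℝ) := by
    intro a b ha hb hx'
    refine Set.disjoint_left.2 fun t ht htP => ?_
    refine hεP (a := t) ?_ ⟨htP, ?_⟩
    · rw [Real.ball_eq_Ioo]; exact ⟨by linarith [ht.1], by linarith [ht.2]⟩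
    · rintro rfl
      rcases hx' with h | h
      · linarith [ht.2]
      · linarith [ht.1]
  -- At an end of [0, 1] one of the two half-neighbourhoods is a single point; it is treated
  -- separately because smooth pieces have positive length.
  have hl : IntegrableOn (deriv γ) (Icc (max 0 (x - ε)) x) := by
    rcases eq_or_lt_of_le hx.1 with h0 | h0
    · have : Icc (max 0 (x - ε)) x ⊆ {x} := fun t ht =>
        le_antisymm ht.2 (h0 ▸ (le_max_left _ _).trans ht.1)
      exact (integrableOn_singleton (hx := by simp)).mono_set this
    · exact hpiece _ _ (le_max_left _ _) (max_lt h0 (by linarith)) hx.2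
        (hP' _ _ (le_max_right _ _) (by linarith) (Or.inl le_rfl))
  have hr : IntegrableOn (deriv γ) (Icc x (min 1 (x + ε))) := by
    rcases eq_or_lt_of_le hx.2 with h0 | h0
    · have : Icc x (min 1 (x + ε)) ⊆ {x} := fun t ht =>
        le_antisymm (h0 ▸ ht.2.trans (min_le_left _ _)) ht.1
      exact (integrableOn_singleton (hx := by simp)).mono_set this
    · exact hpiece _ _ hx.1 (lt_min h0 (by linarith)) (min_le_left _ _)
        (hP' _ _ (by linarith) (min_le_right _ _) (Or.inr le_rfl))
  refine ⟨Icc 0 1 ∩ Ioo (x - ε) (x + ε), inter_mem self_mem_nhdsWithin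
    (mem_nhdsWithin_of_mem_nhds (Ioo_mem_nhds (by linarith) (by linarith))),
    (hl.union hr).mono_set ?_⟩
  rintro t ⟨ht, ht'⟩
  rcases le_total t x with h | h
  · exact Or.inl ⟨max_le ht.1 ht'.1.le, h⟩
  · exact Or.inr ⟨h, le_min ht.2 ht'.2.le⟩

/-- The integral of `g(z) dz` along the curve `γ` with parameter interval `[0, 1]`. -/
noncomputable def curveInt (γ : ℝ → ℂ) (g : ℂ → ℂ) : ℂ := ∫ t in (0 : ℝ)..1, g (γ t) * deriv γ t

section Curve

variable {γ : ℝ → ℂ} (hγ : ContinuousOn γ (Icc 0 1))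
  (hγ' : IntervalIntegrable (deriv γ) volume 0 1)

include hγ hγ'

theorem intervalIntegrable_comp_mul_deriv {S : Set ℂ} (hS : ∀ t ∈ Icc (0 : ℝ) 1, γ t ∈ S)
    {g : ℂ → ℂ} (hg : ContinuousOn g S) :
    IntervalIntegrable (fun t => g (γ t) * deriv γ t) volume 0 1 := by
  refine hγ'.continuousOn_mul ?_
  rw [uIcc_of_le zero_le_one]
  exact hg.comp hγ hS

/-- Integrals of kernels `k z w dw` along a curve are holomorphic in `z`. -/
theorem differentiableOn_curveInt {S U : Set ℂ} (hS : ∀ t ∈ Icc (0 : ℝ) 1, γ t ∈ S)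
    (hU : IsOpen U) {k : ℂ → ℂ → ℂ} (hk : ∀ z ∈ U, ContinuousOn (k z) S)
    (hk' : ∀ w ∈ S, DifferentiableOn ℂ (k · w) U)
    (hb : ∀ z ∈ U, ∃ r > 0, ∃ M : ℝ, ∀ z' ∈ ball z r, ∀ w ∈ S, ‖k z' w‖ ≤ M) :
    DifferentiableOn ℂ (fun z => curveInt γ (k z)) U := by
  have hsub : ∀ᵐ t ∂(volume.restrict (Ioc (0 : ℝ) 1)), γ t ∈ S :=
    (ae_restrict_iff' measurableSet_Ioc).2 (Eventually.of_forall fun t ht =>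
      hS t (Ioc_subset_Icc_self ht))
  simp only [curveInt, intervalIntegral.integral_of_le zero_le_one]
  refine differentiableOn_integral_of_locally_dominated hU (fun z hz => ?_) ?_ fun z hz => ?_
  · exact (intervalIntegrable_comp_mul_deriv hγ hγ' hS (hk z hz)).1.aestronglyMeasurable
  · filter_upwards [hsub] with t ht
    exact (hk' _ ht).mul_const _
  · obtain ⟨r, hr, M, hM⟩ := hb z hz
    refine ⟨r, hr, fun t => M * ‖deriv γ t‖, hγ'.1.norm.const_mul M, ?_⟩
    filter_upwards [hsub] with t ht w hw
    rw [norm_mul]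
    exact mul_le_mul_of_nonneg_right (hM w hw _ ht) (norm_nonneg _)

omit hγ in
theorem norm_curveInt_le {S : Set ℂ} (hS : ∀ t ∈ Icc (0 : ℝ) 1, γ t ∈ S)
    {g : ℂ → ℂ} {M : ℝ} (hM : ∀ w ∈ S, ‖g w‖ ≤ M) :
    ‖curveInt γ g‖ ≤ M * ∫ t in (0 : ℝ)..1, ‖deriv γ t‖ := by
  rw [curveInt, ← intervalIntegral.integral_const_mul]
  refine intervalIntegral.norm_integral_le_of_norm_le zero_le_one ?_ (hγ'.norm.const_mul M)
  refine Eventually.of_forall fun t ht => ?_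
  rw [norm_mul]
  exact mul_le_mul_of_nonneg_right (hM _ (hS t (Ioc_subset_Icc_self ht))) (norm_nonneg _)

omit hγ in
/-- Cauchy type integrals tend to zero at infinity. -/
theorem tendsto_curveInt_div_sub {S : Set ℂ} (hSc : IsCompact S)
    (hS : ∀ t ∈ Icc (0 : ℝ) 1, γ t ∈ S) {g : ℂ → ℂ} (hg : ContinuousOn g S) :
    Tendsto (fun z => curveInt γ fun w => g w / (w - z)) (cocompact ℂ) (𝓝 0) := by
  obtain ⟨M, hM⟩ := hSc.exists_bound_of_continuousOn hg
  obtain ⟨R, hR⟩ := hSc.isBounded.exists_norm_le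
  have h0 : Tendsto (fun z : ℂ => |M| / (‖z‖ - R) * ∫ t in (0 : ℝ)..1, ‖deriv γ t‖)
      (cocompact ℂ) (𝓝 0) := by
    have h1 : Tendsto (fun z : ℂ => ‖z‖ - R) (cocompact ℂ) atTop := by
      simpa only [sub_eq_add_neg] using
        tendsto_atTop_add_const_right _ (-R) (tendsto_norm_cocompact_atTop (E := ℂ))
    simpa only [zero_mul] using
      (h1.const_div_atTop |M|).mul_const (∫ t in (0 : ℝ)..1, ‖deriv γ t‖)
  refine squeeze_zero_norm' ?_ h0
  filter_upwards [(tendsto_norm_cocompact_atTop (E := ℂ)).eventually_gt_atTop R] with z hz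
  refine norm_curveInt_le hγ' hS fun w hw => ?_
  rw [norm_div]
  have h1 : ‖z‖ - R ≤ ‖w - z‖ := by
    have := norm_sub_norm_le z w
    rw [norm_sub_rev] at this
    linarith [hR w hw]
  exact div_le_div₀ (abs_nonneg _) ((hM w hw).trans (le_abs_self M)) (by linarith) h1

end Curve

/-- Transfers holomorphy of the difference quotient from its second point to its first. -/
theorem dslope_swap (g : ℂ → ℂ) (z w : ℂ) : dslope g z w = dslope g w z := by
  rcases eq_or_ne w z with rfl | h
  · rfl
  · rw [dslope_of_ne _ h, dslope_of_ne _ h.symm, slope_comm]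

/-- Difference quotients of a holomorphic function are locally bounded, uniformly with respect
to the second point in a compact set. -/
theorem exists_bound_dslope {g : ℂ → ℂ} {Ω L : Set ℂ} (hΩ : IsOpen Ω)
    (hg : DifferentiableOn ℂ g Ω) (hL : IsCompact L) (hLΩ : L ⊆ Ω) {z : ℂ} (hz : z ∈ Ω) :
    ∃ r > 0, ∃ M : ℝ, ∀ z' ∈ ball z r, ∀ w ∈ L, ‖dslope g z' w‖ ≤ M := by
  obtain ⟨R, hR, hRΩ⟩ := Metric.isOpen_iff.1 hΩ z hz
  have hsub : closedBall z (R / 2) ⊆ Ω := (closedBall_subset_ball (by linarith)).trans hRΩ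
  have hc : IsCompact (closedBall z (R / 2)) := isCompact_closedBall _ _
  obtain ⟨M₀, hM₀⟩ := (hL.union hc).exists_bound_of_continuousOn
    (hg.continuousOn.mono (union_subset hLΩ hsub))
  obtain ⟨M₁, hM₁⟩ := hc.exists_bound_of_continuousOn ((hg.deriv hΩ).continuousOn.mono hsub)
  refine ⟨R / 4, by positivity, max (2 * M₀ / (R / 4)) M₁, fun z' hz' w hw => ?_⟩
  have hz'' : z' ∈ closedBall z (R / 2) := ball_subset_closedBall (ball_subset_ball (by linarith) hz')
  -- Near `z` the mean value inequality on a convex ball gives the bound `M₁`; away from it the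
  -- denominator is at least `R / 4`.
  by_cases hwz : w ∈ closedBall z (R / 2)
  · refine le_trans ?_ (le_max_right _ _)
    rcases eq_or_ne w z' with rfl | hne
    · rw [dslope_same]
      exact hM₁ _ hwz
    · rw [dslope_of_ne _ hne, slope_def_field, norm_div, div_le_iff₀ (norm_pos_iff.2 (sub_ne_zero.2 hne))]
      exact (convex_closedBall z (R / 2)).norm_image_sub_le_of_norm_deriv_le
        (fun x hx => hg.differentiableAt (hΩ.mem_nhds (hsub hx))) hM₁ hz'' hwz
  · refine le_trans ?_ (le_max_left _ _)
    rw [mem_closedBall, not_le] at hwz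
    rw [mem_ball] at hz'
    have hd : R / 4 ≤ ‖w - z'‖ := by
      rw [← dist_eq_norm]
      linarith [dist_triangle w z' z]
    have hne : w ≠ z' := by
      rintro rfl
      rw [sub_self, norm_zero] at hd
      linarith
    rw [dslope_of_ne _ hne, slope_def_field, norm_div]
    refine div_le_div₀ ?_ ?_ (by positivity) hd
    · linarith [(norm_nonneg _).trans (hM₀ w (Or.inl hw))]
    · refine (norm_sub_le _ _).trans ?_
      linarith [hM₀ w (Or.inl hw), hM₀ z' (Or.inr hz'')]

/-- **Cauchy's theorem** in its homological form: if a cycle in the compact subset `L` of the open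
set `Ω` does not wind around the points outside `L`, then integrals of functions holomorphic on
`Ω` along this cycle vanish. -/
theorem sum_curveInt_eq_zero {ι : Type*} [Fintype ι] {γ : ι → ℝ → ℂ} (a : ι → ℂ)
    (hγ : ∀ k, ContinuousOn (γ k) (Icc 0 1))
    (hγ' : ∀ k, IntervalIntegrable (deriv (γ k)) volume 0 1) {Ω L : Set ℂ} (hΩ : IsOpen Ω)
    (hL : IsCompact L) (hLΩ : L ⊆ Ω) (hγL : ∀ k, ∀ t ∈ Icc (0 : ℝ) 1, γ k t ∈ L)
    (hn : ∀ z ∉ L, ∑ k, a k * windingNumber (γ k) z = 0)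
    {g : ℂ → ℂ} (hg : DifferentiableOn ℂ g Ω) : ∑ k, a k * curveInt (γ k) g = 0 := by
  classical
  rcases L.eq_empty_or_nonempty with hLe | ⟨z₀, hz₀⟩
  · refine Finset.sum_eq_zero fun k _ => ?_
    exact absurd (hγL k 0 (by simp)) (by simp [hLe])
  have hn' : ∀ z ∉ L, ∑ k, a k * curveInt (γ k) (fun w => 1 / (w - z)) = 0 := by
    intro z hz
    have h1 : ∀ k, curveInt (γ k) (fun w => 1 / (w - z)) =
        (2 * Real.pi * Complex.I) * windingNumber (γ k) z := by
      intro k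
      rw [windingNumber, mul_inv_cancel_left₀ Complex.two_pi_I_ne_zero]
      simp only [curveInt, one_div_mul_eq_div]
    simp only [h1, mul_left_comm (a _), ← Finset.mul_sum, hn z hz, mul_zero]
  -- The factor `w - z₀` makes the difference quotient of `G` at `z₀` equal to `g`, so that
  -- vanishing of the function `h` below at `z₀` is exactly the claim.
  let G : ℂ → ℂ := fun w => g w * (w - z₀)
  have hG : DifferentiableOn ℂ G Ω := hg.mul (by fun_prop)
  have hsub : ∀ z ∉ L, ContinuousOn (fun w : ℂ => 1 / (w - z)) L := fun z hz =>
    continuousOn_const.div (by fun_prop) fun w hw => sub_ne_zero.2 fun h => hz (h ▸ hw)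
  -- Dixon's function. On `Ω` it integrates the difference quotient of `G`, elsewhere the Cauchy
  -- kernel; off `L` both expressions agree, because the extra term is `G z` times a vanishing
  -- winding number. Hence it is entire.
  let h : ℂ → ℂ := fun z => if z ∈ Ω then ∑ k, a k * curveInt (γ k) (dslope G z)
    else ∑ k, a k * curveInt (γ k) fun w => G w / (w - z)
  have hout : ∀ z ∉ L, h z = ∑ k, a k * curveInt (γ k) fun w => G w / (w - z) := by
    intro z hz
    by_cases hzΩ : z ∈ Ω
    · have h1 : ∀ k, curveInt (γ k) (dslope G z) = curveInt (γ k) (fun w => G w / (w - z)) -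
          G z * curveInt (γ k) (fun w => 1 / (w - z)) := by
        intro k
        rw [curveInt, curveInt, curveInt, ← intervalIntegral.integral_const_mul,
          ← intervalIntegral.integral_sub]
        · refine intervalIntegral.integral_congr fun t ht => ?_
          rw [uIcc_of_le zero_le_one] at ht
          have hne : γ k t ≠ z := fun h => hz (h ▸ hγL k t ht)
          simp only [dslope_of_ne _ hne, slope_def_field]
          ring
        · refine intervalIntegrable_comp_mul_deriv (hγ k) (hγ' k) (hγL k)
            (g := fun w => G w / (w - z)) ?_
          simpa only [div_eq_mul_one_div (G _)] using (hG.continuousOn.mono hLΩ).fun_mul (hsub z hz)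
        · exact (intervalIntegrable_comp_mul_deriv (hγ k) (hγ' k) (hγL k) (hsub z hz)).const_mul _
      simp only [h, if_pos hzΩ, h1, mul_sub, Finset.sum_sub_distrib, mul_left_comm (a _),
        ← Finset.mul_sum, hn' z hz, mul_zero, sub_zero]
    · simp only [h, if_neg hzΩ]
  have hdiff : Differentiable ℂ h := by
    intro z
    by_cases hz : z ∈ L
    · have hd : DifferentiableOn ℂ (fun z => ∑ k, a k * curveInt (γ k) (dslope G z)) Ω := by
        refine DifferentiableOn.fun_sum fun k _ => DifferentiableOn.const_mul ?_ _
        refine differentiableOn_curveInt (hγ k) (hγ' k) (hγL k) hΩ (fun z hz => ?_)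
          (fun w hw => ?_) fun z hz => exists_bound_dslope hΩ hG hL hLΩ hz
        · exact (((Complex.differentiableOn_dslope (hΩ.mem_nhds hz)).2 hG).continuousOn).mono hLΩ
        · simp only [dslope_swap G _ w]
          exact (Complex.differentiableOn_dslope (hΩ.mem_nhds (hLΩ hw))).2 hG
      refine (hd.congr fun z hz => ?_).differentiableAt (hΩ.mem_nhds (hLΩ hz))
      simp only [h, if_pos hz]
    · have hd : DifferentiableOn ℂ
          (fun z => ∑ k, a k * curveInt (γ k) fun w => G w / (w - z)) Lᶜ := by
        refine DifferentiableOn.fun_sum fun k _ => DifferentiableOn.const_mul ?_ _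
        obtain ⟨M, hM⟩ := hL.exists_bound_of_continuousOn (hG.continuousOn.mono hLΩ)
        refine differentiableOn_curveInt (hγ k) (hγ' k) (hγL k) hL.isClosed.isOpen_compl
          (fun z hz => ?_) (fun w hw => ?_) fun z hz => ?_
        · simpa only [div_eq_mul_one_div (G _)] using
            (hG.continuousOn.mono hLΩ).fun_mul (hsub z hz)
        · exact DifferentiableOn.div (by fun_prop) (by fun_prop) fun z hz =>
            sub_ne_zero.2 fun h => hz (h ▸ hw)
        · obtain ⟨R, hR, hRL⟩ := Metric.isOpen_iff.1 hL.isClosed.isOpen_compl z hz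
          refine ⟨R / 2, by positivity, |M| / (R / 2), fun z' hz' w hw => ?_⟩
          rw [norm_div]
          refine div_le_div₀ (abs_nonneg _) ((hM w hw).trans (le_abs_self M)) (by positivity) ?_
          by_contra! hlt
          refine hRL (a := w) ?_ hw
          rw [← dist_eq_norm] at hlt
          rw [mem_ball] at hz' ⊢
          linarith [dist_triangle w z' z]
      exact (hd.congr hout).differentiableAt (hL.isClosed.isOpen_compl.mem_nhds hz)
  have hlim : Tendsto h (cocompact ℂ) (𝓝 0) := by
    have h1 : Tendsto (fun z => ∑ k, a k * curveInt (γ k) fun w => G w / (w - z))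
        (cocompact ℂ) (𝓝 0) := by
      rw [show (0 : ℂ) = ∑ k, a k * 0 by simp]
      exact tendsto_finsetSum _ fun k _ => (tendsto_curveInt_div_sub (hγ' k) hL (hγL k)
        (hG.continuousOn.mono hLΩ)).const_mul _
    refine h1.congr' ?_
    filter_upwards [hL.compl_mem_cocompact] with z hz using (hout z hz).symm
  -- Liouville: an entire function tending to zero at infinity is zero.
  have hzero := hdiff.apply_eq_of_tendsto_cocompact z₀ hlim
  have hz₀Ω := hLΩ hz₀
  have hds : ∀ w, dslope G z₀ w = g w := by
    intro w
    rcases eq_or_ne w z₀ with rfl | hne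
    · rw [dslope_same]
      have h1 := ((hg.differentiableAt (hΩ.mem_nhds hz₀Ω)).hasDerivAt).fun_mul
        ((hasDerivAt_id w).sub_const w)
      simpa using h1.deriv
    · rw [dslope_of_ne _ hne, slope_def_field]
      simp only [G, sub_self, mul_zero, sub_zero]
      exact mul_div_cancel_right₀ _ (sub_ne_zero.2 hne)
  simp only [h, if_pos hz₀Ω, funext hds] at hzero
  exact hzero

end CliffordSFC

/-! ### Clifford conjugation as an adjoint. -/

namespace CliffordSFC

section Algebra

variable {d : ℕ} {H : Type*} [NormedAddCommGroup H] [InnerProductSpace ℝ H]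

/-- Adding a new largest index m to S contributes |S| + 1 minus signs in the row of m and none in
the other rows. Thus the sign in the conjugation is that of e_A², which means conj(e_A) = e_A⁻¹. -/
theorem sgn_self (A : Finset (Fin d)) : sgn A A = (-1) ^ (A.card * (A.card + 1) / 2) := by
  induction A using Finset.induction_on_max with
  | empty => simp [sgn]
  | insert m S hS ih =>
    have hm : m ∉ S := fun h => lt_irrefl _ (hS m h)
    have h1 : ∏ i ∈ S, ∏ j ∈ insert m S, (if j ≤ i then (-1 : ℝ) else 1) = sgn S S := by
      refine Finset.prod_congr rfl fun i hi => ?_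
      rw [Finset.prod_insert hm, if_neg (not_le.2 (hS i hi)), one_mul]
    have h2 : ∏ j ∈ insert m S, (if j ≤ m then (-1 : ℝ) else 1) = (-1) ^ (S.card + 1) := by
      rw [← Finset.card_insert_of_notMem hm, ← Finset.prod_const]
      refine Finset.prod_congr rfl fun j hj => if_pos ?_
      rcases Finset.mem_insert.1 hj with rfl | h
      · exact le_rfl
      · exact (hS j h).le
    have h3 : (S.card + 1) * (S.card + 1 + 1) / 2 = S.card * (S.card + 1) / 2 + (S.card + 1) := by
      rw [show (S.card + 1) * (S.card + 1 + 1) = S.card * (S.card + 1) + (S.card + 1) * 2 by ring,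
        Nat.add_mul_div_right _ _ two_pos]
    rw [sgn, Finset.prod_insert hm, h1, h2, ih, Finset.card_insert_of_notMem hm, h3, pow_add]
    ring

theorem conj_apply (a : Cl d) (A : Finset (Fin d)) : conj a A = sgn A A * a A := by
  rw [sgn_self]; rfl

theorem conj_conj (a : Cl d) : conj (conj a) = a := by
  ext A
  rw [conj_apply, conj_apply, ← mul_assoc, sgn_mul_self, one_mul]

/-- Clifford conjugation as a linear isometry. -/
noncomputable def conjIsometry (d : ℕ) : Cl d ≃ₗᵢ[ℝ] Cl d where
  toFun := conj
  invFun := conj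
  left_inv := conj_conj
  right_inv := conj_conj
  map_add' a b := by ext A; simp [conj_apply, mul_add]
  map_smul' r a := by ext A; simp [conj_apply]; ring
  norm_map' a := by
    simp only [EuclideanSpace.norm_eq]
    congr 1
    refine Finset.sum_congr rfl fun A _ => ?_
    change ‖conj a A‖ ^ 2 = _
    rw [conj_apply, norm_mul, mul_pow, Real.norm_eq_abs (sgn A A), sq_abs, sq, sgn_mul_self,
      one_mul]

theorem conjIsometry_apply (a : Cl d) : conjIsometry d a = conj a := rfl

/-- Multiplication by e_B is a signed permutation of the coefficients, hence orthogonal, and its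
adjoint is its inverse, multiplication by conj(e_B). The reindexing C ↦ B ∆ C expresses this. -/
theorem inner_lmul_left (a : Cl d) (v w : HMod d H) :
    ⟪lmul a v, w⟫_ℝ = ⟪v, lmul (conj a) w⟫_ℝ := by
  simp only [PiLp.inner_apply, lmul_apply, sum_inner, inner_sum, real_inner_smul_left,
    real_inner_smul_right]
  rw [Finset.sum_comm]
  conv_rhs => rw [Finset.sum_comm]
  refine Finset.sum_congr rfl fun B _ => ?_
  refine Finset.sum_bij' (fun C _ => B ∆ C) (fun C _ => B ∆ C) (by simp) (by simp)
    (fun C _ => symmDiff_symmDiff_cancel_left B C) (fun C _ => symmDiff_symmDiff_cancel_left B C)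
    fun C _ => ?_
  rw [symmDiff_symmDiff_cancel_left, conj_apply, sgn_symmDiff_right]
  ring

theorem inner_rmul_left (a : Cl d) (v w : HMod d H) :
    ⟪rmul a v, w⟫_ℝ = ⟪v, rmul (conj a) w⟫_ℝ := by
  simp only [PiLp.inner_apply, rmul_apply, sum_inner, inner_sum, real_inner_smul_left,
    real_inner_smul_right]
  rw [Finset.sum_comm]
  conv_rhs => rw [Finset.sum_comm]
  refine Finset.sum_congr rfl fun B _ => ?_
  refine Finset.sum_bij' (fun C _ => B ∆ C) (fun C _ => B ∆ C) (by simp) (by simp)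
    (fun C _ => symmDiff_symmDiff_cancel_left B C) (fun C _ => symmDiff_symmDiff_cancel_left B C)
    fun C _ => ?_
  rw [symmDiff_symmDiff_cancel_left, conj_apply, sgn_symmDiff_left]
  ring

/-- Left multiplication by conj(a) is the adjoint of left multiplication by a, and adjoints reverse
products; evaluation at 1 recovers the Clifford numbers. -/
theorem conj_mul (a b : Cl d) : conj (a * b) = conj b * conj a := by
  have h : ∀ v : HMod d ℝ, lmul (H := ℝ) (conj (a * b)) v = lmul (conj b * conj a) v := by
    intro v
    refine ext_inner_left ℝ fun w => ?_
    rw [← inner_lmul_left, lmul_mul, lmul_mul, ContinuousLinearMap.comp_apply,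
      ContinuousLinearMap.comp_apply, inner_lmul_left, inner_lmul_left]
  have h1 := h (1 : Cl d)
  rw [← mul_def, ← mul_def, mul_one, mul_one] at h1
  exact h1

/-- Left multiplication as a linear map in the Clifford number. -/
noncomputable def lmulₗ : Cl d →ₗ[ℝ] HMod d H →L[ℝ] HMod d H where
  toFun := lmul
  map_add' := lmul_add
  map_smul' := lmul_smul

theorem continuous_lmul : Continuous (lmul (H := H) : Cl d → HMod d H →L[ℝ] HMod d H) :=
  LinearMap.continuous_of_finiteDimensional (lmulₗ (H := H))

theorem lmul_neg (a : Cl d) : lmul (H := H) (-a) = -lmul a := map_neg (lmulₗ (H := H)) a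

theorem lmul_sum {ι : Type*} (s : Finset ι) (a : ι → Cl d) :
    lmul (H := H) (∑ i ∈ s, a i) = ∑ i ∈ s, lmul (a i) := map_sum (lmulₗ (H := H)) a s

/-- The basis vector `e_A`. -/
noncomputable def e (A : Finset (Fin d)) : Cl d := EuclideanSpace.single A 1

theorem eq_sum_e (a : Cl d) : a = ∑ A, a A • e A := by
  ext C
  simp [e, Pi.single_apply]

theorem e_empty : e (∅ : Finset (Fin d)) = 1 := rfl

theorem conj_e (A : Finset (Fin d)) : conj (e A) = sgn A A • e A := by
  ext C
  rw [conj_apply]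
  by_cases h : C = A
  · simp [h, e]
  · simp [h, e]

end Algebra

/-! ### Imaginary units and the planes ℂ_J. -/

section Units

variable {d : ℕ} {J : Paravector d}

theorem coe_ofReal (x : ℝ) : ((ofReal x : Paravector d) : Cl d) = x • (1 : Cl d) := rfl

theorem coe_slicePt (J : Paravector d) (z : ℂ) :
    (slicePt J z : Cl d) = z.re • (1 : Cl d) + z.im • (J : Cl d) := rfl

theorem conj_one : conj (1 : Cl d) = 1 := by
  rw [← e_empty, conj_e]
  simp [sgn]

theorem conj_coe_of_mem (hJ : J ∈ imUnits d) : conj (J : Cl d) = -(J : Cl d) := by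
  ext A
  rw [conj_apply, sgn_self]
  rcases Nat.lt_trichotomy A.card 1 with h | h | h
  · rw [Nat.lt_one_iff, Finset.card_eq_zero] at h
    have : (J : Cl d) ∅ = 0 := hJ.1
    simp [h, this]
  · simp [h]
  · simp [J.2 A h]

theorem inner_self_of_mem (hJ : J ∈ imUnits d) : ⟪(J : Cl d), (J : Cl d)⟫_ℝ = 1 := by
  have h : ‖(J : Cl d)‖ = 1 := hJ.2
  rw [real_inner_self_eq_norm_sq, h, one_pow]

/-- J is a vector, so J² is a scalar; moving one factor across the inner product gives ⟪JJ, 1⟫ = ⟪J,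
conj J⟫ = -‖J‖² = -1. -/
theorem coe_mul_self_of_mem (hJ : J ∈ imUnits d) : (J : Cl d) * J = -1 := by
  have hv : (J : Cl d) = vec d fun i => (J : Cl d) {i} := by
    rw [vec_apply]
    ext A
    rcases Nat.lt_trichotomy A.card 1 with h | h | h
    · rw [Nat.lt_one_iff, Finset.card_eq_zero] at h
      have h0 : (J : Cl d) ∅ = 0 := hJ.1
      simp [h, h0, unit]
    · obtain ⟨i, rfl⟩ := Finset.card_eq_one.1 h
      simp [unit, Pi.single_apply]
    · have h1 : ∀ i : Fin d, A ≠ {i} := fun i hi => by simp [hi] at h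
      simp [J.2 A h, unit, h1]
  have h1 : ∀ r : ℝ, algebraMap ℝ (Cl d) r = r • (1 : Cl d) :=
    fun r => Algebra.algebraMap_eq_smul_one r
  obtain ⟨r, hr⟩ : ∃ r : ℝ, (J : Cl d) * J = r • (1 : Cl d) := by
    rw [hv, vec_mul_vec, h1]
    exact ⟨_, rfl⟩
  have h2 : ⟪(J : Cl d) * J, (1 : Cl d)⟫_ℝ = -1 := by
    rw [mul_def]
    have := inner_lmul_left (H := ℝ) (J : Cl d) (J : Cl d) (1 : Cl d)
    rw [← mul_def (conj (J : Cl d)), mul_one, conj_coe_of_mem hJ, inner_neg_right,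
      inner_self_of_mem hJ] at this
    exact this
  have h3 : ⟪(1 : Cl d), (1 : Cl d)⟫_ℝ = 1 := by simp [one_def]
  rw [hr, real_inner_smul_left, h3, mul_one] at h2
  rw [hr, h2, neg_smul, one_smul]

theorem re_slicePt (hJ : J ∈ imUnits d) (z : ℂ) : re (slicePt J z) = z.re := by
  have h0 : (J : Cl d) ∅ = 0 := hJ.1
  rw [re, coe_slicePt]
  simp [h0, one_def]

theorem norm_slicePt_sq (hJ : J ∈ imUnits d) (z : ℂ) : ‖slicePt J z‖ ^ 2 = Complex.normSq z := by
  have h0 : (J : Cl d) ∅ = 0 := hJ.1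
  have h1 : ⟪(1 : Cl d), (J : Cl d)⟫_ℝ = 0 := by
    rw [one_def, EuclideanSpace.inner_single_left, h0, mul_zero]
  have h2 : ‖(1 : Cl d)‖ = 1 := by simp [one_def]
  have h3 : ‖(J : Cl d)‖ = 1 := hJ.2
  rw [← Submodule.norm_coe, coe_slicePt, norm_add_sq_real, real_inner_smul_left,
    real_inner_smul_right, h1, norm_smul, norm_smul, h2, h3, Complex.normSq_apply]
  simp only [mul_one, mul_zero, add_zero, Real.norm_eq_abs, sq_abs]
  ring

theorem norm_im_slicePt (hJ : J ∈ imUnits d) (z : ℂ) : ‖im (slicePt J z)‖ = |z.im| := by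
  rw [im, re_slicePt hJ, slicePt, add_sub_cancel_left, norm_smul, hJ.2, mul_one, Real.norm_eq_abs]

theorem neg_mem_imUnits (hJ : J ∈ imUnits d) : -J ∈ imUnits d := by
  refine ⟨?_, by rw [norm_neg]; exact hJ.2⟩
  have h0 : (J : Cl d) ∅ = 0 := hJ.1
  simp [re, h0]

theorem slicePt_neg (J : Paravector d) (z : ℂ) :
    slicePt (-J) z = slicePt J (starRingEnd ℂ z) := by
  simp [slicePt]

theorem continuous_slicePt (J : Paravector d) : Continuous (slicePt J) := by
  refine Continuous.add ?_ (Complex.continuous_im.smul continuous_const)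
  exact Complex.continuous_re.smul continuous_const

theorem coe_slicePt_mul (hJ : J ∈ imUnits d) (z w : ℂ) :
    (slicePt J (z * w) : Cl d) = slicePt J z * slicePt J w := by
  simp only [coe_slicePt, add_mul, mul_add, smul_mul_smul_comm, mul_one, one_mul,
    coe_mul_self_of_mem hJ, Complex.mul_re, Complex.mul_im]
  module

theorem conj_slicePt (hJ : J ∈ imUnits d) (z : ℂ) :
    conj (slicePt J z : Cl d) = slicePt J (starRingEnd ℂ z) := by
  rw [← conjIsometry_apply, coe_slicePt, map_add, map_smul, map_smul, conjIsometry_apply,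
    conjIsometry_apply, conj_one, conj_coe_of_mem hJ, coe_slicePt, Complex.conj_re,
    Complex.conj_im, neg_smul, smul_neg]

theorem pconj_slicePt (hJ : J ∈ imUnits d) (z : ℂ) :
    pconj (slicePt J z) = slicePt J (starRingEnd ℂ z) := Subtype.ext (conj_slicePt hJ z)

/-- An axially symmetric set is determined by its intersection with one plane `ℂ_J`. -/
theorem AxiallySymmetric.slicePt_mem {U : Set (Paravector d)} (hU : AxiallySymmetric U)
    (hJ : J ∈ imUnits d) {J' : Paravector d} (hJ' : J' ∈ imUnits d) {z : ℂ}
    (h : slicePt J z ∈ U) : slicePt J' z ∈ U := by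
  have h1 : ∀ I ∈ imUnits d, ofReal z.re + |z.im| • I ∈ U := fun I hI => by
    have := hU _ h I hI
    rwa [re_slicePt hJ, norm_im_slicePt hJ] at this
  -- Axial symmetry only yields the points with |y|; for negative y the unit -J' is used.
  rcases abs_choice z.im with h2 | h2
  · have := h1 J' hJ'
    rwa [h2] at this
  · have := h1 (-J') (neg_mem_imUnits hJ')
    rwa [h2, neg_smul_neg] at this

theorem AxiallySymmetric.slicePt_conj_mem {U : Set (Paravector d)} (hU : AxiallySymmetric U)
    (hJ : J ∈ imUnits d) {z : ℂ} (h : slicePt J z ∈ U) : slicePt J (starRingEnd ℂ z) ∈ U := by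
  rw [← slicePt_neg]
  exact hU.slicePt_mem hJ (neg_mem_imUnits hJ) h

theorem mem_profile_compl_iff {K : Set (Paravector d)} (hK : AxiallySymmetric K)
    (hJ : J ∈ imUnits d) {z : ℂ} : z ∈ profile Kᶜ ↔ slicePt J z ∉ K :=
  ⟨fun h => h J hJ, fun h _ hJ' h' => h (hK.slicePt_mem hJ' hJ h')⟩

/-- Every paravector lies in a plane `ℂ_J`, provided that there are imaginary units at all. -/
theorem exists_eq_slicePt (hJ : J ∈ imUnits d) (s : Paravector d) :
    ∃ I ∈ imUnits d, ∃ z, s = slicePt I z := by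
  by_cases h : im s = 0
  · refine ⟨J, hJ, ⟨re s, 0⟩, ?_⟩
    rw [im, sub_eq_zero] at h
    simp [slicePt, ← h]
  · have h0 : ‖im s‖ ≠ 0 := norm_ne_zero_iff.2 h
    have hre : re (im s) = 0 := by
      simp [im, re, coe_ofReal, one_def]
    refine ⟨‖im s‖⁻¹ • im s, ⟨?_, ?_⟩, ⟨re s, ‖im s‖⟩, ?_⟩
    · change ‖im s‖⁻¹ * re (im s) = 0
      rw [hre, mul_zero]
    · rw [norm_smul, norm_inv, norm_norm, inv_mul_cancel₀ h0]
    · rw [slicePt, smul_inv_smul₀ h0, im, add_sub_cancel]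

end Units

end CliffordSFC

/-! ### Pseudo-resolvents: perturbation, adjoints and holomorphy. -/

namespace CliffordSFC

open Filter Topology ContinuousLinearMap

/-- In a Banach algebra, the elements `1 - 2 (x - x₀) a + (|z| ^ 2 - |z₀| ^ 2) b` are invertible
near `z₀`, and the inverse is real differentiable at `z₀`. -/
theorem exists_inverse_near {𝔸 : Type*} [NormedRing 𝔸] [NormedAlgebra ℝ 𝔸] [CompleteSpace 𝔸]
    (a b : 𝔸) (z₀ : ℂ) : ∃ (B : ℂ → 𝔸) (B' : ℂ →L[ℝ] 𝔸), HasFDerivAt B B' z₀ ∧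
      (∀ ζ, B' ζ = (2 * ζ.re) • a - (2 * (z₀.re * ζ.re + z₀.im * ζ.im)) • b) ∧
      ∀ᶠ z in 𝓝 z₀,
        (1 - (2 * (z.re - z₀.re)) • a + (Complex.normSq z - Complex.normSq z₀) • b) * B z = 1 ∧
        B z * (1 - (2 * (z.re - z₀.re)) • a + (Complex.normSq z - Complex.normSq z₀) • b) = 1 := by
  let D : ℂ → 𝔸 := fun z =>
    1 - (2 * (z.re - z₀.re)) • a + (Complex.normSq z - Complex.normSq z₀) • b
  have hD0 : D z₀ = 1 := by simp [D]
  have hre : HasFDerivAt (fun z : ℂ => z.re) Complex.reCLM z₀ := Complex.reCLM.hasFDerivAt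
  have him : HasFDerivAt (fun z : ℂ => z.im) Complex.imCLM z₀ := Complex.imCLM.hasFDerivAt
  have hD := ((hasFDerivAt_const (1 : 𝔸) z₀).fun_sub
    (((hre.sub_const z₀.re).const_mul 2).smul_const a)).fun_add
    ((((hre.mul hre).fun_add (him.mul him)).sub_const (Complex.normSq z₀)).smul_const b)
  have hD' : HasFDerivAt D _ z₀ := hD
  -- At 1 the derivative of inversion is -id, so `B'` is minus the derivative of `D`.
  have hinv := hasFDerivAt_ringInverse (𝕜 := ℝ) (1 : 𝔸ˣ)
  rw [Units.val_one, ← hD0] at hinv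
  refine ⟨_, _, hinv.comp z₀ hD', fun ζ => ?_, ?_⟩
  · simp
    module
  · have hu : ∀ᶠ z in 𝓝 z₀, IsUnit (D z) := by
      refine hD'.continuousAt.eventually (p := IsUnit) ?_
      rw [hD0]
      exact Units.isOpen.mem_nhds isUnit_one
    filter_upwards [hu] with z hz
    exact ⟨Ring.mul_inverse_cancel _ hz, Ring.inverse_mul_cancel _ hz⟩

/-- With A = TR, the operator inverted here is Q_z[T] R, where R = Q_{z₀}[T]⁻¹. Derivatives are
recorded only for matrix coefficients, so that the Cauchy–Riemann equations can be checked on real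
functions without complexifying the Hilbert space. -/
theorem exists_inverse_operator_near {E : Type*} [NormedAddCommGroup E] [InnerProductSpace ℝ E]
    [CompleteSpace E] (A R : E →L[ℝ] E) (z₀ : ℂ) : ∃ B : ℂ → E →L[ℝ] E,
      (∀ S : E →L[ℝ] E, ContinuousAt (fun z => S ∘L B z) z₀) ∧
      (∀ (S : E →L[ℝ] E) (v w : E), ∃ L : ℂ →L[ℝ] ℝ,
        HasFDerivAt (fun z => ⟪S (B z v), w⟫_ℝ) L z₀ ∧ ∀ ζ, L ζ = 2 * ζ.re * ⟪S (A v), w⟫_ℝ -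
          2 * (z₀.re * ζ.re + z₀.im * ζ.im) * ⟪S (R v), w⟫_ℝ) ∧
      ∀ᶠ z in 𝓝 z₀,
        (∀ v, B z v - (2 * (z.re - z₀.re)) • A (B z v) +
          (Complex.normSq z - Complex.normSq z₀) • R (B z v) = v) ∧
        ∀ v, B z (v - (2 * (z.re - z₀.re)) • A v +
          (Complex.normSq z - Complex.normSq z₀) • R v) = v := by
  obtain ⟨B, B', hB, hB', hnear⟩ := exists_inverse_near A R z₀
  refine ⟨B, fun S => continuousAt_const.clm_comp hB.continuousAt, fun S v w =>
    ⟨(innerSL ℝ w ∘L S ∘L ContinuousLinearMap.apply ℝ E v) ∘L B', ?_, fun ζ => ?_⟩, ?_⟩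
  · refine HasFDerivAt.congr_of_eventuallyEq
      ((innerSL ℝ w ∘L S ∘L ContinuousLinearMap.apply ℝ E v).hasFDerivAt.comp z₀ hB)
      (Eventually.of_forall fun ζ => ?_)
    simp [real_inner_comm]
  · simp [hB', inner_sub_right, real_inner_smul_right, real_inner_comm w]
  · filter_upwards [hnear] with z hz
    exact ⟨fun v => DFunLike.congr_fun hz.1 v, fun v => DFunLike.congr_fun hz.2 v⟩

variable {d : ℕ} {H : Type*} [NormedAddCommGroup H] [InnerProductSpace ℝ H]

section Graph

variable {T : HMod d H →ₗ.[ℝ] HMod d H}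

theorem mem_graph_of_eq {u w : HMod d H} (h : u ∈ T.domain) (hw : T ⟨u, h⟩ = w) :
    (u, w) ∈ T.graph := (LinearPMap.mem_graph_iff T).2 ⟨⟨u, h⟩, rfl, hw⟩

theorem exists_of_mem_graph {u w : HMod d H} (h : (u, w) ∈ T.graph) :
    ∃ h : u ∈ T.domain, T ⟨u, h⟩ = w := by
  obtain ⟨y, hy, hw⟩ := (LinearPMap.mem_graph_iff T).1 h
  subst hy
  exact ⟨y.2, hw⟩

/-- Membership in the graph of T* becomes a pairing identity over the graph of T; domain questions
for T* and its square reduce to such identities. -/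
theorem mem_graph_adjoint_iff [CompleteSpace H] (hdense : Dense (T.domain : Set (HMod d H)))
    {x y : HMod d H} :
    (x, y) ∈ T.adjoint.graph ↔ ∀ u w, (u, w) ∈ T.graph → ⟪y, u⟫_ℝ = ⟪x, w⟫_ℝ := by
  constructor
  · intro h u w huw
    obtain ⟨hx, rfl⟩ := exists_of_mem_graph h
    obtain ⟨hu, rfl⟩ := exists_of_mem_graph huw
    exact LinearPMap.adjoint_isFormalAdjoint hdense ⟨x, hx⟩ ⟨u, hu⟩
  · intro h
    have h1 : ∀ u : T.domain, ⟪y, (u : HMod d H)⟫_ℝ = ⟪x, T u⟫_ℝ := fun u =>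
      h _ _ (mem_graph_of_eq u.2 rfl)
    exact mem_graph_of_eq (LinearPMap.mem_adjoint_domain_of_exists x ⟨y, h1⟩)
      (LinearPMap.adjoint_apply_eq hdense _ h1)

theorem IsRightLinear.rmul_mem_graph (hT : IsRightLinear T) {u w : HMod d H}
    (h : (u, w) ∈ T.graph) (a : Cl d) : (rmul a u, rmul a w) ∈ T.graph := by
  obtain ⟨hu, rfl⟩ := exists_of_mem_graph h
  obtain ⟨h1, h2⟩ := hT ⟨u, hu⟩ a
  exact mem_graph_of_eq h1 h2

theorem isRightLinear_of_graph
    (h : ∀ u w, (u, w) ∈ T.graph → ∀ a : Cl d, (rmul a u, rmul a w) ∈ T.graph) :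
    IsRightLinear T := fun v a => exists_of_mem_graph (h v (T v) (mem_graph_of_eq v.2 rfl) a)

/-- The adjoint of right multiplication by a is right multiplication by conj(a), which preserves the
graph of T. -/
theorem IsRightLinear.adjoint [CompleteSpace H] (hT : IsRightLinear T)
    (hdense : Dense (T.domain : Set (HMod d H))) : IsRightLinear T.adjoint := by
  refine isRightLinear_of_graph fun x y hxy a => ?_
  rw [mem_graph_adjoint_iff hdense] at hxy ⊢
  intro u w huw
  rw [inner_rmul_left, inner_rmul_left]
  exact hxy _ _ (hT.rmul_mem_graph huw _)

/-- For `R = (T ^ 2 - 2 x T + r)⁻¹` and `A = T R`, the properties of these operators in terms of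
the graph of `T`. -/
structure IsResolventPair (T : HMod d H →ₗ.[ℝ] HMod d H) (x r : ℝ)
    (R A : HMod d H →L[ℝ] HMod d H) : Prop where
  rightLinear : ∀ v a, R (rmul a v) = rmul a (R v)
  mem_graph : ∀ v, (R v, A v) ∈ T.graph
  mem_graph' : ∀ v, (A v, v + (2 * x) • A v - r • R v) ∈ T.graph
  left_inv : ∀ u w y, (u, w) ∈ T.graph → (w, y) ∈ T.graph → R (y - (2 * x) • w + r • u) = u

theorem isResolventPair_of_mem [CompleteSpace H] (hT : T.IsClosed) {s : Paravector d}
    (hs : s ∈ rhoS T) : IsResolventPair T (re s) (‖s‖ ^ 2) (Qinv T s) (TQinv T s) := by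
  have h := Qinv_spec hs
  refine ⟨h.rightLinear, fun v => ?_, fun v => ?_, fun u w y huw hwy => ?_⟩
  · obtain ⟨hv, e⟩ := TQinv_spec hT hs v
    exact mem_graph_of_eq hv e.symm
  · obtain ⟨hv, e⟩ := h.right_inv v
    obtain ⟨hv', e'⟩ := TQinv_spec hT hs v
    obtain ⟨h1, h2⟩ := mem_domSq.1 hv
    change T ⟨T ⟨Qinv T s v, h1⟩, h2⟩ - (2 * re s) • T ⟨Qinv T s v, h1⟩ +
      (‖s‖ ^ 2) • Qinv T s v = v at e
    rw [e']
    refine mem_graph_of_eq h2 ?_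
    rw [eq_sub_iff_add_eq, ← sub_eq_iff_eq_add]
    refine Eq.trans ?_ e
    abel
  · obtain ⟨hu, rfl⟩ := exists_of_mem_graph huw
    obtain ⟨hw, rfl⟩ := exists_of_mem_graph hwy
    exact h.left_inv ⟨u, mem_domSq.2 ⟨hu, hw⟩⟩

namespace IsResolventPair

variable {x r : ℝ} {R A : HMod d H →L[ℝ] HMod d H}

theorem isPseudoResolvent {s : Paravector d} (h : IsResolventPair T (re s) (‖s‖ ^ 2) R A) :
    IsPseudoResolvent T s R := by
  refine ⟨h.rightLinear, fun v => ?_, fun v => ?_⟩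
  · obtain ⟨h1, e1⟩ := exists_of_mem_graph (h.mem_graph v)
    obtain ⟨h2, e2⟩ := exists_of_mem_graph (h.mem_graph' v)
    have h3 : T ⟨R v, h1⟩ ∈ T.domain := by rw [e1]; exact h2
    refine ⟨mem_domSq.2 ⟨h1, h3⟩, ?_⟩
    change T ⟨T ⟨R v, h1⟩, h3⟩ - (2 * re s) • T ⟨R v, h1⟩ + (‖s‖ ^ 2) • R v = v
    have h4 : T ⟨T ⟨R v, h1⟩, h3⟩ = v + (2 * re s) • A v - (‖s‖ ^ 2) • R v := by
      rw [← e2]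
      congr 1
      exact Subtype.ext e1
    rw [h4, e1]
    abel
  · obtain ⟨hv, hv'⟩ := mem_domSq.1 v.2
    exact h.left_inv _ _ _ (mem_graph_of_eq hv rfl) (mem_graph_of_eq hv' rfl)

theorem mem_rhoS {s : Paravector d} (h : IsResolventPair T (re s) (‖s‖ ^ 2) R A) : s ∈ rhoS T :=
  ⟨R, h.isPseudoResolvent⟩

/-- `Qinv` is obtained by choice, so uniqueness of the inverse is what identifies it with a concrete
operator. -/
theorem Qinv_eq {s : Paravector d} (h : IsResolventPair T (re s) (‖s‖ ^ 2) R A) :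
    Qinv T s = R := (Qinv_spec h.mem_rhoS).unique h.isPseudoResolvent

theorem snd_eq_of_mem_graph {v w : HMod d H} (h : IsResolventPair T x r R A)
    (hw : (R v, w) ∈ T.graph) : A v = w :=
  LinearPMap.mem_graph_snd_inj T (h.mem_graph v) hw rfl

theorem TQinv_eq [CompleteSpace H] (hT : T.IsClosed) {s : Paravector d}
    (h : IsResolventPair T (re s) (‖s‖ ^ 2) R A) : TQinv T s = A := by
  ext1 v
  obtain ⟨hv, e⟩ := TQinv_spec hT h.mem_rhoS v
  rw [e]
  refine (h.snd_eq_of_mem_graph ?_).symm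
  rw [← h.Qinv_eq]
  exact mem_graph_of_eq hv rfl

/-- `T` commutes with its pseudo-resolvents. -/
theorem apply_eq_of_mem_graph (h : IsResolventPair T x r R A) {u w : HMod d H}
    (huw : (u, w) ∈ T.graph) : R w = A u := by
  -- `p` is T A u. As u lies in dom T, so does `p`; hence A u lies in dom T², and applying T² - 2xT
  -- + r to A u gives w.
  set p := u + (2 * x) • A u - r • R u with hp
  have h1 : (p, w + (2 * x) • p - r • A u) ∈ T.graph :=
    T.graph.sub_mem (T.graph.add_mem huw (T.graph.smul_mem (2 * x) (h.mem_graph' u)))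
      (T.graph.smul_mem r (h.mem_graph u))
  rw [← h.left_inv _ _ _ (h.mem_graph' u) h1]
  congr 1
  rw [hp]
  abel

theorem rightLinear_snd (hT : IsRightLinear T) (h : IsResolventPair T x r R A) (v : HMod d H)
    (a : Cl d) : A (rmul a v) = rmul a (A v) := by
  refine h.snd_eq_of_mem_graph ?_
  rw [h.rightLinear]
  exact hT.rmul_mem_graph (h.mem_graph v) a

/-- Each graph relation for T* is tested against the graph of T, where it becomes a relation between
R, A and T: that T commutes with R, or that A w = u + 2xAu - rRu for w = Tu. Left invertibility is
the transpose of right invertibility for T. In this way no comparison of (T²)* with (T*)² is needed.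
-/
theorem adjoint [CompleteSpace H] (hdense : Dense (T.domain : Set (HMod d H)))
    (h : IsResolventPair T x r R A) :
    IsResolventPair T.adjoint x r (ContinuousLinearMap.adjoint R)
      (ContinuousLinearMap.adjoint A) := by
  refine ⟨fun v a => ?_, fun v => ?_, fun v => ?_, fun u w y huw hwy => ?_⟩
  · refine ext_inner_right ℝ fun u => ?_
    rw [adjoint_inner_left, inner_rmul_left, inner_rmul_left, adjoint_inner_left, h.rightLinear]
  · rw [mem_graph_adjoint_iff hdense]
    intro u w huw
    rw [adjoint_inner_left, adjoint_inner_left, h.apply_eq_of_mem_graph huw]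
  · rw [mem_graph_adjoint_iff hdense]
    intro u w huw
    have h1 : A w = u + (2 * x) • A u - r • R u :=
      h.snd_eq_of_mem_graph (by rw [h.apply_eq_of_mem_graph huw]; exact h.mem_graph' u)
    rw [adjoint_inner_left, h1]
    simp only [inner_add_left, inner_sub_left, inner_add_right, inner_sub_right,
      real_inner_smul_left, real_inner_smul_right, adjoint_inner_left]
  · rw [mem_graph_adjoint_iff hdense] at huw hwy
    refine ext_inner_right ℝ fun v => ?_
    rw [adjoint_inner_left]
    simp only [inner_add_left, inner_sub_left, real_inner_smul_left]
    rw [hwy _ _ (h.mem_graph v), huw _ _ (h.mem_graph' v), huw _ _ (h.mem_graph v)]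
    simp only [inner_add_right, inner_sub_right, real_inner_smul_right]
    ring

/-- Pseudo-resolvents at neighbouring points. -/
theorem perturb (hT : IsRightLinear T) (h : IsResolventPair T x r R A) {x' r' : ℝ}
    {B : HMod d H →L[ℝ] HMod d H}
    (e1 : ∀ v, B v - (2 * (x' - x)) • A (B v) + (r' - r) • R (B v) = v)
    (e2 : ∀ v, B (v - (2 * (x' - x)) • A v + (r' - r) • R v) = v) :
    IsResolventPair T x' r' (R ∘L B) (A ∘L B) := by
  refine ⟨fun v a => ?_, fun v => h.mem_graph _, fun v => ?_, fun u w y huw hwy => ?_⟩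
  · have h3 : B (rmul a v) = rmul a (B v) := by
      conv_lhs => rw [← e1 v]
      rw [map_add, map_sub, map_smul, map_smul, ← h.rightLinear, ← h.rightLinear_snd hT, e2]
    change R (B (rmul a v)) = rmul a (R (B v))
    rw [h3, h.rightLinear]
  · have h3 := h.mem_graph' (B v)
    have h4 : v + (2 * x') • A (B v) - r' • R (B v) =
        B v + (2 * x) • A (B v) - r • R (B v) := by
      linear_combination (norm := module) (-1 : ℝ) • e1 v
    rw [← h4] at h3
    exact h3
  · have h3 := h.left_inv u w y huw hwy
    have h4 : A (y - (2 * x) • w + r • u) = w := h.snd_eq_of_mem_graph (by rw [h3]; exact huw)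
    have h5 := e2 (y - (2 * x) • w + r • u)
    rw [h3, h4] at h5
    change R (B _) = u
    conv_rhs => rw [← h3, ← h5]
    congr 2
    module

end IsResolventPair

end Graph

theorem _root_.Complex.differentiableAt_of_cauchyRiemann {u v : ℂ → ℝ} {u' v' : ℂ →L[ℝ] ℝ} {z : ℂ}
    (hu : HasFDerivAt u u' z) (hv : HasFDerivAt v v' z) (h1 : u' 1 = v' Complex.I)
    (h2 : u' Complex.I = -v' 1) : DifferentiableAt ℂ (fun z => (⟨u z, v z⟩ : ℂ)) z := by
  have h : HasFDerivAt (fun z => (⟨u z, v z⟩ : ℂ))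
      (Complex.equivRealProdCLM.symm.toContinuousLinearMap ∘L u'.prod v') z :=
    Complex.equivRealProdCLM.symm.hasFDerivAt.comp z (hu.prodMk hv)
  refine differentiableAt_complex_iff_differentiableAt_real.2 ⟨h.differentiableAt, ?_⟩
  rw [h.fderiv]
  apply Complex.ext
  · simp [h2]
  · simp [h1]

/-! ### Holomorphy of the resolvent in a plane ℂ_J. -/

section Holomorphic

variable [CompleteSpace H] {T : HMod d H →ₗ.[ℝ] HMod d H} {J : Paravector d}

/-- The parameters Re z and |z|² do not involve J; this is what makes every later change of plane
possible. -/
theorem resolventPair_slicePt (hT : T.IsClosed) (hJ : J ∈ imUnits d) {z : ℂ}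
    (hz : slicePt J z ∈ rhoS T) : IsResolventPair T z.re (Complex.normSq z)
      (Qinv T (slicePt J z)) (TQinv T (slicePt J z)) := by
  have h := isResolventPair_of_mem hT hz
  rwa [re_slicePt hJ, norm_slicePt_sq hJ] at h

omit [CompleteSpace H] in
theorem IsResolventPair.mem_rhoS_slicePt (hJ : J ∈ imUnits d) {z : ℂ}
    {R A : HMod d H →L[ℝ] HMod d H} (h : IsResolventPair T z.re (Complex.normSq z) R A) :
    slicePt J z ∈ rhoS T := by
  rw [← re_slicePt hJ, ← norm_slicePt_sq hJ] at h
  exact h.mem_rhoS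

theorem IsResolventPair.eq_slicePt (hT : T.IsClosed) (hJ : J ∈ imUnits d) {z : ℂ}
    {R A : HMod d H →L[ℝ] HMod d H} (h : IsResolventPair T z.re (Complex.normSq z) R A) :
    Qinv T (slicePt J z) = R ∧ TQinv T (slicePt J z) = A := by
  rw [← re_slicePt hJ, ← norm_slicePt_sq hJ] at h
  exact ⟨h.Qinv_eq, h.TQinv_eq hT⟩

/-- Near a point `z₀` of the resolvent set, the pseudo-resolvents are the products of the one at
`z₀` and a function that is real differentiable at `z₀`. -/
theorem exists_pseudoResolvent_near (hT : IsClosedRightLinear T) (hJ : J ∈ imUnits d) {z₀ : ℂ}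
    (hz₀ : slicePt J z₀ ∈ rhoS T) :
    ∃ B : ℂ → HMod d H →L[ℝ] HMod d H,
      (∀ S : HMod d H →L[ℝ] HMod d H, ContinuousAt (fun z => S ∘L B z) z₀) ∧
      (∀ (S : HMod d H →L[ℝ] HMod d H) (v w : HMod d H), ∃ L : ℂ →L[ℝ] ℝ,
        HasFDerivAt (fun z => ⟪S (B z v), w⟫_ℝ) L z₀ ∧
        ∀ ζ, L ζ = 2 * ζ.re * ⟪S (TQinv T (slicePt J z₀) v), w⟫_ℝ -
          2 * (z₀.re * ζ.re + z₀.im * ζ.im) * ⟪S (Qinv T (slicePt J z₀) v), w⟫_ℝ) ∧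
      ∀ᶠ z in 𝓝 z₀, slicePt J z ∈ rhoS T ∧
        Qinv T (slicePt J z) = Qinv T (slicePt J z₀) ∘L B z ∧
        TQinv T (slicePt J z) = TQinv T (slicePt J z₀) ∘L B z := by
  obtain ⟨B, h1, h2, hnear⟩ :=
    exists_inverse_operator_near (TQinv T (slicePt J z₀)) (Qinv T (slicePt J z₀)) z₀
  refine ⟨B, h1, h2, ?_⟩
  filter_upwards [hnear] with z hz
  have h3 := (resolventPair_slicePt hT.2 hJ hz₀).perturb hT.1 hz.1 hz.2
  exact ⟨h3.mem_rhoS_slicePt hJ, h3.eq_slicePt hT.2 hJ⟩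

theorem isOpen_setOf_slicePt_mem_rhoS (hT : IsClosedRightLinear T) (hJ : J ∈ imUnits d) :
    IsOpen {z | slicePt J z ∈ rhoS T} := by
  refine isOpen_iff_mem_nhds.2 fun z hz => ?_
  obtain ⟨B, -, -, h⟩ := exists_pseudoResolvent_near hT hJ hz
  filter_upwards [h] with w hw using hw.1

theorem continuousAt_Qinv_slicePt (hT : IsClosedRightLinear T) (hJ : J ∈ imUnits d) {z : ℂ}
    (hz : slicePt J z ∈ rhoS T) : ContinuousAt (fun z => Qinv T (slicePt J z)) z := by
  obtain ⟨B, hB, -, h⟩ := exists_pseudoResolvent_near hT hJ hz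
  exact (hB _).congr (h.mono fun w hw => hw.2.1.symm)

theorem continuousAt_TQinv_slicePt (hT : IsClosedRightLinear T) (hJ : J ∈ imUnits d) {z : ℂ}
    (hz : slicePt J z ∈ rhoS T) : ContinuousAt (fun z => TQinv T (slicePt J z)) z := by
  obtain ⟨B, hB, -, h⟩ := exists_pseudoResolvent_near hT hJ hz
  exact (hB _).congr (h.mono fun w hw => hw.2.2.symm)

/-- The matrix coefficients of `-(T - z)⁻¹ = (x - T) Q_z[T]⁻¹ - i y Q_z[T]⁻¹`. -/
noncomputable def resolventForm (T : HMod d H →ₗ.[ℝ] HMod d H) (J : Paravector d)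
    (v w : HMod d H) (z : ℂ) : ℂ :=
  ⟨z.re * ⟪Qinv T (slicePt J z) v, w⟫_ℝ - ⟪TQinv T (slicePt J z) v, w⟫_ℝ,
    -(z.im * ⟪Qinv T (slicePt J z) v, w⟫_ℝ)⟩

/-- The Cauchy–Riemann equations follow from the derivatives of the pseudo-resolvents, once products
of A and R are reduced by AR = RA and A² = R + 2xRA - |z|²R². -/
theorem differentiableAt_resolventForm (hT : IsClosedRightLinear T) (hJ : J ∈ imUnits d) {z : ℂ}
    (hz : slicePt J z ∈ rhoS T) (v w : HMod d H) :
    DifferentiableAt ℂ (resolventForm T J v w) z := by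
  obtain ⟨B, -, hB, hnear⟩ := exists_pseudoResolvent_near hT hJ hz
  have h := resolventPair_slicePt hT.2 hJ hz
  set R := Qinv T (slicePt J z)
  set A := TQinv T (slicePt J z)
  obtain ⟨ρ', hρ, hρ'⟩ := hB R v w
  obtain ⟨α', hα, hα'⟩ := hB A v w
  have hR : HasFDerivAt (fun ζ => ⟪Qinv T (slicePt J ζ) v, w⟫_ℝ) ρ' z :=
    hρ.congr_of_eventuallyEq (hnear.mono fun ζ hζ => by beta_reduce; rw [hζ.2.1]; rfl)
  have hA : HasFDerivAt (fun ζ => ⟪TQinv T (slicePt J ζ) v, w⟫_ℝ) α' z :=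
    hα.congr_of_eventuallyEq (hnear.mono fun ζ hζ => by beta_reduce; rw [hζ.2.2]; rfl)
  have hre : HasFDerivAt (fun z : ℂ => z.re) Complex.reCLM z := Complex.reCLM.hasFDerivAt
  have him : HasFDerivAt (fun z : ℂ => z.im) Complex.imCLM z := Complex.imCLM.hasFDerivAt
  have hAR : A (R v) = R (A v) := (h.apply_eq_of_mem_graph (h.mem_graph v)).symm
  -- A(Av) = R(TAv), because T commutes with R, and TAv is known from the resolvent equation.
  have hAA : A (A v) = R v + (2 * z.re) • R (A v) - Complex.normSq z • R (R v) := by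
    rw [← h.apply_eq_of_mem_graph (h.mem_graph' v), map_sub, map_add, map_smul, map_smul]
  refine Complex.differentiableAt_of_cauchyRiemann ((hre.mul hR).fun_sub hA) (him.mul hR).fun_neg
    ?_ ?_
  · simp [hρ', hα', hAR, hAA, Complex.normSq_apply, inner_sub_left, inner_add_left,
      real_inner_smul_left]
    ring
  · simp [hρ', hα', hAR, hAA, Complex.normSq_apply, inner_sub_left, inner_add_left,
      real_inner_smul_left]
    ring

end Holomorphic

end CliffordSFC

/-! ### Boundary curves: independence of the contour and reflection in the real axis. -/

namespace CliffordSFC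

open MeasureTheory Filter Topology Set

theorem deriv_conj_comp (γ : ℝ → ℂ) (t : ℝ) :
    deriv (fun t => starRingEnd ℂ (γ t)) t = starRingEnd ℂ (deriv γ t) := deriv.star

theorem intervalIntegral_conj (g : ℝ → ℂ) :
    ∫ t in (0 : ℝ)..1, starRingEnd ℂ (g t) = starRingEnd ℂ (∫ t in (0 : ℝ)..1, g t) := by
  simp only [intervalIntegral.integral_of_le zero_le_one]
  exact integral_conj

theorem curveInt_conj_comp (γ : ℝ → ℂ) (g : ℂ → ℂ) :
    curveInt (fun t => starRingEnd ℂ (γ t)) g =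
      starRingEnd ℂ (curveInt γ fun z => starRingEnd ℂ (g (starRingEnd ℂ z))) := by
  rw [curveInt, curveInt, ← intervalIntegral_conj]
  simp only [deriv_conj_comp, map_mul, Complex.conj_conj]

theorem windingNumber_eq_curveInt (γ : ℝ → ℂ) (z : ℂ) :
    windingNumber γ z = (2 * Real.pi * Complex.I)⁻¹ * curveInt γ fun w => 1 / (w - z) := by
  simp only [windingNumber, curveInt, one_div_mul_eq_div]

/-- Reflection reverses orientation; the sign comes from conjugating the factor 1/(2πi). -/
theorem windingNumber_conj_comp (γ : ℝ → ℂ) (z : ℂ) :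
    windingNumber (fun t => starRingEnd ℂ (γ t)) z =
      -starRingEnd ℂ (windingNumber γ (starRingEnd ℂ z)) := by
  rw [windingNumber_eq_curveInt, windingNumber_eq_curveInt, curveInt_conj_comp, map_mul]
  simp [map_ofNat]

theorem curveInt_congr {γ : ℝ → ℂ} {g h : ℂ → ℂ} (hgh : ∀ t ∈ Icc (0 : ℝ) 1, g (γ t) = h (γ t)) :
    curveInt γ g = curveInt γ h := by
  refine intervalIntegral.integral_congr fun t ht => ?_
  rw [uIcc_of_le zero_le_one] at ht
  rw [hgh t ht]

namespace IsPositiveBoundary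

variable {n m : ℕ} {γ : Fin n → ℝ → ℂ} {γ' : Fin m → ℝ → ℂ} {D D' : Set ℂ}

theorem mem_frontier (h : IsPositiveBoundary γ D) (k : Fin n) {t : ℝ} (ht : t ∈ Icc (0 : ℝ) 1) :
    γ k t ∈ frontier D := by
  rw [h.frontier_eq]
  exact mem_iUnion.2 ⟨k, mem_image_of_mem _ ht⟩

/-- The total winding number is 1 on D but tends to 0 at infinity, so D is bounded without this
being assumed. -/
theorem isCompact_closure (h : IsPositiveBoundary γ D) : IsCompact (closure D) := by
  have hlim : Tendsto (fun z => ∑ k, windingNumber (γ k) z) (cocompact ℂ) (𝓝 0) := by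
    rw [show (0 : ℂ) = ∑ k : Fin n, (2 * Real.pi * Complex.I)⁻¹ * 0 by simp]
    refine tendsto_finsetSum _ fun k _ => ?_
    rw [show windingNumber (γ k) = fun z => _ from funext (windingNumber_eq_curveInt (γ k))]
    refine Tendsto.const_mul _ ?_
    exact tendsto_curveInt_div_sub (h.curve k).intervalIntegrable_deriv
      (isCompact_Icc.image_of_continuousOn (h.curve k).continuousOn)
      (fun t ht => mem_image_of_mem _ ht) (g := fun _ => 1) continuousOn_const
  have h1 := hlim.eventually (Metric.ball_mem_nhds 0 one_pos)
  obtain ⟨L, hL, hLs⟩ := mem_cocompact.1 h1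
  refine (hL.closure_of_subset fun z hz => ?_)
  by_contra hzL
  have h2 := hLs hzL
  rw [mem_ofPred_eq, h.inside z hz] at h2
  simp at h2

/-- Two systems of curves which bound open sets have the same integrals of functions that are
holomorphic on the closures outside the intersection of these open sets. -/
theorem sum_curveInt_eq (h : IsPositiveBoundary γ D) (h' : IsPositiveBoundary γ' D')
    (hD : IsOpen D) (hD' : IsOpen D') {Ω : Set ℂ} (hΩ : IsOpen Ω)
    (hsub : closure D \ (D ∩ D') ⊆ Ω) (hsub' : closure D' \ (D ∩ D') ⊆ Ω) {g : ℂ → ℂ}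
    (hg : DifferentiableOn ℂ g Ω) : ∑ k, curveInt (γ k) g = ∑ k, curveInt (γ' k) g := by
  -- The cycle is γ - γ'. Off this compact set its winding number is 1 - 1 on D ∩ D' and 0 - 0
  -- outside both closures, and both frontiers lie in the set because D and D' are open.
  have hL : IsCompact ((closure D ∪ closure D') \ (D ∩ D')) :=
    (h.isCompact_closure.union h'.isCompact_closure).diff (hD.inter hD')
  have key := sum_curveInt_eq_zero (γ := Sum.elim γ γ')
    (Sum.elim (fun _ => (1 : ℂ)) fun _ => -1) ?_ ?_ hΩ hL ?_ ?_ ?_ hg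
  · simpa [← sub_eq_add_neg, sub_eq_zero] using key
  · rintro (k | k)
    exacts [(h.curve k).continuousOn, (h'.curve k).continuousOn]
  · rintro (k | k)
    exacts [(h.curve k).intervalIntegrable_deriv, (h'.curve k).intervalIntegrable_deriv]
  · rw [union_sdiff_distrib]
    exact union_subset hsub hsub'
  · rintro (k | k) t ht
    · have := h.mem_frontier k ht
      rw [hD.frontier_eq] at this
      exact ⟨Or.inl this.1, fun hz => this.2 hz.1⟩
    · have := h'.mem_frontier k ht
      rw [hD'.frontier_eq] at this
      exact ⟨Or.inr this.1, fun hz => this.2 hz.2⟩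
  · intro z hz
    simp only [Fintype.sum_sum_type, Sum.elim_inl, Sum.elim_inr, one_mul, neg_mul,
      Finset.sum_neg_distrib]
    by_cases hzD : z ∈ D ∩ D'
    · rw [h.inside z hzD.1, h'.inside z hzD.2, add_neg_cancel]
    · have hz' : z ∉ closure D ∪ closure D' := fun h => hz ⟨h, hzD⟩
      rw [mem_union, not_or] at hz'
      rw [h.outside z hz'.1, h'.outside z hz'.2, neg_zero, add_zero]

/-- For a bounding system of curves of a set that is symmetric about the real axis, complex
conjugation changes the sign of integrals. -/
theorem sum_curveInt_conj_comp (h : IsPositiveBoundary γ D) (hD : IsOpen D)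
    (hDc : ∀ z ∈ D, starRingEnd ℂ z ∈ D) {Ω : Set ℂ} (hΩ : IsOpen Ω) (hsub : frontier D ⊆ Ω)
    {g : ℂ → ℂ} (hg : DifferentiableOn ℂ g Ω) :
    ∑ k, curveInt (fun t => starRingEnd ℂ (γ k t)) g = -∑ k, curveInt (γ k) g := by
  have hcl : ∀ z ∈ closure D, starRingEnd ℂ z ∈ closure D := fun z hz =>
    map_mem_closure Complex.continuous_conj hz hDc
  have hfr : ∀ z ∈ frontier D, starRingEnd ℂ z ∈ frontier D := by
    intro z hz
    rw [hD.frontier_eq] at hz ⊢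
    refine ⟨hcl z hz.1, fun h1 => hz.2 ?_⟩
    simpa using hDc _ h1
  have hL : IsCompact (frontier D) :=
    h.isCompact_closure.of_isClosed_subset isClosed_frontier frontier_subset_closure
  -- The cycle is γ plus its mirror image; off the frontier the winding numbers cancel, by the
  -- symmetry of D.
  have key := sum_curveInt_eq_zero (ι := Fin n ⊕ Fin n)
    (γ := Sum.elim (fun k t => starRingEnd ℂ (γ k t)) γ) (fun _ => (1 : ℂ)) ?_ ?_ hΩ hL hsub
      ?_ ?_ hg
  · simpa [add_eq_zero_iff_eq_neg] using key
  · rintro (k | k)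
    exacts [Complex.continuous_conj.comp_continuousOn (h.curve k).continuousOn,
      (h.curve k).continuousOn]
  · rintro (k | k)
    · simp only [Sum.elim_inl]
      rw [show deriv (fun t => starRingEnd ℂ (γ k t)) = fun t => starRingEnd ℂ (deriv (γ k) t) from
        funext (deriv_conj_comp _)]
      have h1 := (h.curve k).intervalIntegrable_deriv
      exact ⟨Complex.conjCLE.toContinuousLinearMap.integrable_comp h1.1,
        Complex.conjCLE.toContinuousLinearMap.integrable_comp h1.2⟩
    · exact (h.curve k).intervalIntegrable_deriv
  · rintro (k | k) t ht
    exacts [hfr _ (h.mem_frontier k ht), h.mem_frontier k ht]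
  · intro z hz
    simp only [Fintype.sum_sum_type, Sum.elim_inl, Sum.elim_inr, one_mul, windingNumber_conj_comp,
      Finset.sum_neg_distrib, ← map_sum]
    rw [hD.frontier_eq] at hz
    by_cases hzD : z ∈ D
    · rw [h.inside z hzD, h.inside _ (hDc z hzD), map_one, neg_add_cancel]
    · have hz' : z ∉ closure D := fun h => hz ⟨h, hzD⟩
      have hz'' : starRingEnd ℂ z ∉ closure D := fun h => hz' (by simpa using hcl _ h)
      rw [h.outside z hz', h.outside _ hz'', map_zero, neg_zero, add_zero]

end IsPositiveBoundary

variable {d : ℕ} {H : Type*} [NormedAddCommGroup H] [InnerProductSpace ℝ H] [CompleteSpace H]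
  {T : HMod d H →ₗ.[ℝ] HMod d H} {K : Set (Paravector d)} {J J' : Paravector d}

section ResolventForm

theorem Qinv_slicePt_congr (hT : T.IsClosed) (hJ : J ∈ imUnits d) (hJ' : J' ∈ imUnits d) {z : ℂ}
    (hz : slicePt J z ∈ rhoS T) : Qinv T (slicePt J' z) = Qinv T (slicePt J z) ∧
      TQinv T (slicePt J' z) = TQinv T (slicePt J z) :=
  (resolventPair_slicePt hT hJ hz).eq_slicePt hT hJ'

theorem slicePt_mem_rhoS (hT : T.IsClosed) (hJ : J ∈ imUnits d) (hJ' : J' ∈ imUnits d) {z : ℂ}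
    (hz : slicePt J z ∈ rhoS T) : slicePt J' z ∈ rhoS T :=
  (resolventPair_slicePt hT hJ hz).mem_rhoS_slicePt hJ'

theorem resolventForm_congr (hT : T.IsClosed) (hJ : J ∈ imUnits d) (hJ' : J' ∈ imUnits d) {z : ℂ}
    (hz : slicePt J z ∈ rhoS T) (v w : HMod d H) :
    resolventForm T J' v w z = resolventForm T J v w z := by
  obtain ⟨h1, h2⟩ := Qinv_slicePt_congr hT hJ hJ' hz
  rw [resolventForm, resolventForm, h1, h2]

/-- The conjugate of z in ℂ_J is z in ℂ_{-J}, where R and A are unchanged; only the explicit factor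
Im z changes sign. -/
theorem resolventForm_conj (hT : T.IsClosed) (hJ : J ∈ imUnits d) {z : ℂ}
    (hz : slicePt J z ∈ rhoS T) (v w : HMod d H) :
    resolventForm T J v w (starRingEnd ℂ z) = starRingEnd ℂ (resolventForm T J v w z) := by
  obtain ⟨h1, h2⟩ := Qinv_slicePt_congr hT hJ (neg_mem_imUnits hJ) hz
  rw [slicePt_neg] at h1 h2
  rw [resolventForm, resolventForm, h1, h2]
  apply Complex.ext <;> simp

theorem slicePt_mem_rhoS_adjoint (hT : T.IsClosed) (hdense : Dense (T.domain : Set (HMod d H)))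
    {s : Paravector d} (hs : s ∈ rhoS T) : s ∈ rhoS T.adjoint :=
  ((isResolventPair_of_mem hT hs).adjoint hdense).mem_rhoS

/-- The operators for T* are R* and A*, and the inner product is real and symmetric, so the vectors
are exchanged with no complex conjugation of z. -/
theorem resolventForm_adjoint (hT : T.IsClosed) (hdense : Dense (T.domain : Set (HMod d H)))
    (hJ : J ∈ imUnits d) {z : ℂ} (hz : slicePt J z ∈ rhoS T) (v w : HMod d H) :
    resolventForm T.adjoint J v w z = resolventForm T J w v z := by
  have h0 : IsResolventPair T.adjoint z.re (Complex.normSq z) _ _ :=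
    (resolventPair_slicePt hT hJ hz).adjoint hdense
  have h : T.adjoint.IsClosed := LinearPMap.adjoint_isClosed hdense
  obtain ⟨h1, h2⟩ := h0.eq_slicePt h hJ
  have e : ∀ S : HMod d H →L[ℝ] HMod d H, ⟪ContinuousLinearMap.adjoint S v, w⟫_ℝ = ⟪S w, v⟫_ℝ :=
    fun S => by rw [ContinuousLinearMap.adjoint_inner_left, real_inner_comm]
  rw [resolventForm, resolventForm, h1, h2, e, e]

end ResolventForm

theorem isOpen_profile (hK : AxiallySymmetric K) (hKc : IsClosed K) (hJ : J ∈ imUnits d) :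
    IsOpen (profile Kᶜ) := by
  have : profile Kᶜ = slicePt J ⁻¹' Kᶜ := Set.ext fun z => mem_profile_compl_iff hK hJ
  rw [this]
  exact hKc.isOpen_compl.preimage (continuous_slicePt J)

theorem isOpen_rhoS_inter_profile (hT : IsClosedRightLinear T) (hK : AxiallySymmetric K)
    (hKc : IsClosed K) (hJ : J ∈ imUnits d) :
    IsOpen ({z | slicePt J z ∈ rhoS T} ∩ profile Kᶜ) :=
  (isOpen_setOf_slicePt_mem_rhoS hT hJ).inter (isOpen_profile hK hKc hJ)

theorem differentiableOn_mul_resolventForm (hT : IsClosedRightLinear T) (hJ : J ∈ imUnits d)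
    {F : ℂ → ℂ} (hF : DifferentiableOn ℂ F (profile Kᶜ)) (v w : HMod d H) :
    DifferentiableOn ℂ (fun z => F z * resolventForm T J v w z)
      ({z | slicePt J z ∈ rhoS T} ∩ profile Kᶜ) := by
  refine (hF.mono inter_subset_right).fun_mul fun z hz => ?_
  exact (differentiableAt_resolventForm hT hJ hz.1 v w).differentiableWithinAt

namespace Contour

variable (C : Contour T K)

omit [CompleteSpace H] in
theorem isOpen_slice (J : Paravector d) : IsOpen {z | slicePt J z ∈ C.U} :=
  C.isOpen_U.preimage (continuous_slicePt J)

omit [CompleteSpace H] in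
theorem closure_slice_subset : closure {z | slicePt C.J z ∈ C.U} ⊆ {z | slicePt C.J z ∈ rhoS T} :=
  fun _ hz => C.closure_U (map_mem_closure (continuous_slicePt C.J) hz fun _ h => h)

omit [CompleteSpace H] in
theorem pt_mem_rhoS (k : Fin C.n) {t : ℝ} (ht : t ∈ Icc (0 : ℝ) 1) : C.pt k t ∈ rhoS T :=
  C.closure_slice_subset (frontier_subset_closure (C.boundary.mem_frontier k ht))

omit [CompleteSpace H] in
theorem pt_notMem (k : Fin C.n) {t : ℝ} (ht : t ∈ Icc (0 : ℝ) 1) : C.pt k t ∉ K := by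
  have h := C.boundary.mem_frontier k ht
  rw [(C.isOpen_slice C.J).frontier_eq] at h
  exact fun hK => h.2 (C.subset_U hK)

omit [CompleteSpace H] in
theorem γ_mem_profile (hK : AxiallySymmetric K) (k : Fin C.n) {t : ℝ} (ht : t ∈ Icc (0 : ℝ) 1) :
    C.γ k t ∈ profile Kᶜ := (mem_profile_compl_iff hK C.J_mem).2 (C.pt_notMem k ht)

/-- The scalar integrals `-i ∮ F(z) ⟪-(T - z)⁻¹ v, w⟫ dz` over the boundary curves. -/
noncomputable def form (F : ℂ → ℂ) (v w : HMod d H) : ℂ :=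
  -Complex.I * ∑ k, curveInt (C.γ k) fun z => F z * resolventForm T C.J v w z

/-- The integrals do not depend on the contour. -/
theorem form_eq (hT : IsClosedRightLinear T) (hK : AxiallySymmetric K) (hKc : IsClosed K)
    {F : ℂ → ℂ} (hF : DifferentiableOn ℂ F (profile Kᶜ)) (C' : Contour T K) (v w : HMod d H) :
    C.form F v w = C'.form F v w := by
  -- The second integrand is first written in the plane of the first contour.
  have h0 : ∀ k, curveInt (C'.γ k) (fun z => F z * resolventForm T C'.J v w z) =
      curveInt (C'.γ k) (fun z => F z * resolventForm T C.J v w z) := fun k =>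
    curveInt_congr fun t ht => by
      have h1 := slicePt_mem_rhoS hT.2 C'.J_mem C.J_mem (C'.pt_mem_rhoS k ht)
      rw [resolventForm_congr hT.2 C.J_mem C'.J_mem h1]
  have hKD : ∀ z, z ∉ {z | slicePt C.J z ∈ C.U} ∩ {z | slicePt C'.J z ∈ C'.U} →
      z ∈ profile Kᶜ := by
    intro z hz
    refine (mem_profile_compl_iff hK C.J_mem).2 fun h => hz ⟨C.subset_U h, ?_⟩
    exact C'.subset_U (hK.slicePt_mem C.J_mem C'.J_mem h)
  rw [form, form]
  simp only [h0]
  rw [C.boundary.sum_curveInt_eq C'.boundary (C.isOpen_slice _) (C'.isOpen_slice _)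
    (isOpen_rhoS_inter_profile hT hK hKc C.J_mem) ?_ ?_
    (differentiableOn_mul_resolventForm hT C.J_mem hF v w)]
  · rintro z ⟨hz, hz'⟩
    exact ⟨C.closure_slice_subset hz, hKD z hz'⟩
  · rintro z ⟨hz, hz'⟩
    exact ⟨slicePt_mem_rhoS hT.2 C'.J_mem C.J_mem (C'.closure_slice_subset hz), hKD z hz'⟩

/-- The integrals are real for functions with `F(conj z) = conj F(z)`. -/
theorem form_im (hT : IsClosedRightLinear T) (hK : AxiallySymmetric K) (hKc : IsClosed K)
    {F : ℂ → ℂ} (hF : DifferentiableOn ℂ F (profile Kᶜ))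
    (hFc : ∀ z ∈ profile Kᶜ, F (starRingEnd ℂ z) = starRingEnd ℂ (F z)) (v w : HMod d H) :
    (C.form F v w).im = 0 := by
  have h := C.boundary.sum_curveInt_conj_comp (C.isOpen_slice _)
    (fun z hz => C.symm_U.slicePt_conj_mem C.J_mem hz)
    (isOpen_rhoS_inter_profile hT hK hKc C.J_mem) (fun z hz => ?_)
    (differentiableOn_mul_resolventForm hT C.J_mem hF v w)
  · have h1 : ∀ k, curveInt (fun t => starRingEnd ℂ (C.γ k t))
        (fun z => F z * resolventForm T C.J v w z) =
        starRingEnd ℂ (curveInt (C.γ k) fun z => F z * resolventForm T C.J v w z) := by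
      intro k
      rw [curveInt_conj_comp]
      congr 1
      refine curveInt_congr fun t ht => ?_
      rw [hFc _ (C.γ_mem_profile hK k ht),
        resolventForm_conj hT.2 C.J_mem (C.pt_mem_rhoS k ht), ← map_mul, Complex.conj_conj]
    simp only [h1, ← map_sum] at h
    -- The sum I of the integrals satisfies conj I = -I, so Re I = 0 and -iI is real.
    have h2 := congrArg Complex.re h
    rw [Complex.conj_re, Complex.neg_re] at h2
    rw [form, neg_mul, Complex.neg_im, Complex.I_mul_im]
    linarith
  · rw [(C.isOpen_slice C.J).frontier_eq] at hz
    exact ⟨C.closure_slice_subset hz.1,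
      (mem_profile_compl_iff hK C.J_mem).2 fun h => hz.2 (C.subset_U h)⟩

/-- A contour for `T` is a contour for the adjoint of `T`. -/
noncomputable def toAdjoint (hT : T.IsClosed) (hdense : Dense (T.domain : Set (HMod d H))) :
    Contour T.adjoint K where
  __ := C
  closure_U := C.closure_U.trans fun _ hs => slicePt_mem_rhoS_adjoint hT hdense hs

theorem form_toAdjoint (hT : T.IsClosed) (hdense : Dense (T.domain : Set (HMod d H)))
    (F : ℂ → ℂ) (v w : HMod d H) : (C.toAdjoint hT hdense).form F v w = C.form F w v := by
  rw [form, form]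
  congr 1
  refine Finset.sum_congr rfl fun k _ => curveInt_congr fun t ht => ?_
  exact congrArg _ (resolventForm_adjoint hT hdense C.J_mem (C.pt_mem_rhoS k ht) v w)

end Contour

end CliffordSFC

/-! ### Matrix coefficients of the functional calculus. -/

namespace CliffordSFC

open MeasureTheory Filter Topology Set

section Generic

variable {E : Type*}

/-- Pairing under the integral needs integrability in operator norm. The derivative of a boundary
curve is only integrable, so the integrand is split into continuous operator families with its real
and imaginary parts as scalar weights. -/
theorem inner_intervalIntegral_apply [NormedAddCommGroup E] [InnerProductSpace ℝ E]
    [CompleteSpace E] {X P Q : ℝ → E →L[ℝ] E} {c : ℝ → ℂ}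
    (hc : IntervalIntegrable c volume 0 1) (hP : ContinuousOn P (Icc 0 1))
    (hQ : ContinuousOn Q (Icc 0 1)) (hX : ∀ t v, X t v = (c t).im • P t v + (c t).re • Q t v)
    (v w : E) : ⟪(∫ t in (0 : ℝ)..1, X t) v, w⟫_ℝ = ∫ t in (0 : ℝ)..1, ⟪X t v, w⟫_ℝ := by
  have hre : IntervalIntegrable (fun t => (c t).re) volume 0 1 := ⟨hc.1.re, hc.2.re⟩
  have him : IntervalIntegrable (fun t => (c t).im) volume 0 1 := ⟨hc.1.im, hc.2.im⟩
  rw [← uIcc_of_le zero_le_one] at hP hQ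
  have hX' : IntervalIntegrable X volume 0 1 := by
    refine ((him.smul_continuousOn hP).add (hre.smul_continuousOn hQ)).congr fun t _ => ?_
    ext1 v
    exact (hX t v).symm
  have h := (innerSL ℝ w ∘L ContinuousLinearMap.apply ℝ E v).intervalIntegral_comp_comm hX'
  simp only [ContinuousLinearMap.comp_apply, ContinuousLinearMap.apply_apply, innerSL_apply_apply]
    at h
  simp only [real_inner_comm w]
  exact h.symm

theorem intervalIntegral_sum_re_add_im {ι : Type*} [Fintype ι] {g h : ι → ℝ → ℂ}
    (hg : ∀ i, IntervalIntegrable (g i) volume 0 1)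
    (hh : ∀ i, IntervalIntegrable (h i) volume 0 1) :
    ∫ t in (0 : ℝ)..1, ∑ i, ((g i t).re + (h i t).im) =
      ∑ i, ((∫ t in (0 : ℝ)..1, g i t).re + (∫ t in (0 : ℝ)..1, h i t).im) := by
  have hre : ∀ i, IntervalIntegrable (fun t => (g i t).re) volume 0 1 := fun i =>
    ⟨(hg i).1.re, (hg i).2.re⟩
  have him : ∀ i, IntervalIntegrable (fun t => (h i t).im) volume 0 1 := fun i =>
    ⟨(hh i).1.im, (hh i).2.im⟩
  rw [intervalIntegral.integral_finsetSum fun i _ => (hre i).add (him i)]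
  refine Finset.sum_congr rfl fun i _ => ?_
  rw [intervalIntegral.integral_add (hre i) (him i)]
  exact congrArg₂ (· + ·) (Complex.reCLM.intervalIntegral_comp_comm (hg i))
    (Complex.imCLM.intervalIntegral_comp_comm (hh i))

end Generic

variable {d : ℕ} {H : Type*} [NormedAddCommGroup H] [InnerProductSpace ℝ H]
  {T : HMod d H →ₗ.[ℝ] HMod d H} {K : Set (Paravector d)} {J : Paravector d}

section SlicePair

variable {f₀ f₁ : ℂ → Cl d} {D : Set ℂ}

/-- The complex valued functions `F_A = (f_0)_A + i (f_1)_A`. -/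
noncomputable def sliceCoeff (f₀ f₁ : ℂ → Cl d) (A : Finset (Fin d)) (z : ℂ) : ℂ := ⟨f₀ z A, f₁ z A⟩

theorem IsSlicePair.differentiableOn_sliceCoeff (h : IsSlicePair f₀ f₁ D) (hD : IsOpen D)
    (A : Finset (Fin d)) : DifferentiableOn ℂ (sliceCoeff f₀ f₁ A) D := by
  intro z hz
  have h0 := ((h.contDiff₀.differentiableOn one_ne_zero).differentiableAt (hD.mem_nhds hz)).hasFDerivAt
  have h1 := ((h.contDiff₁.differentiableOn one_ne_zero).differentiableAt (hD.mem_nhds hz)).hasFDerivAt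
  let p : Cl d →L[ℝ] ℝ := EuclideanSpace.proj A
  refine (Complex.differentiableAt_of_cauchyRiemann (p.hasFDerivAt.comp z h0)
    (p.hasFDerivAt.comp z h1) ?_ ?_).differentiableWithinAt
  · exact congrArg p (h.cauchyRiemann₁ z hz)
  · simpa using congrArg p (h.cauchyRiemann₂ z hz)

theorem IsSlicePair.sliceCoeff_conj (h : IsSlicePair f₀ f₁ D) (A : Finset (Fin d)) {z : ℂ}
    (hz : z ∈ D) : sliceCoeff f₀ f₁ A (starRingEnd ℂ z) = starRingEnd ℂ (sliceCoeff f₀ f₁ A z) := by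
  rw [sliceCoeff, sliceCoeff, h.even z hz, h.odd z hz]
  rfl

/-- The basis vectors are put on the side away from J, so that each F_A lies in ℂ_J directly beside
ds_J, with which it commutes. -/
theorem add_mul_eq_sum_sliceCoeff (J : Paravector d) (z : ℂ) :
    f₀ z + f₁ z * (J : Cl d) = ∑ A, e A * (slicePt J (sliceCoeff f₀ f₁ A z) : Cl d) := by
  conv_lhs => rw [eq_sum_e (f₀ z), eq_sum_e (f₁ z)]
  rw [Finset.sum_mul, ← Finset.sum_add_distrib]
  refine Finset.sum_congr rfl fun A _ => ?_
  rw [coe_slicePt, mul_add, mul_smul_comm, mul_smul_comm, mul_one, smul_mul_assoc]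
  rfl

theorem add_mul_eq_sum_sliceCoeff' (J : Paravector d) (z : ℂ) :
    f₀ z + (J : Cl d) * f₁ z = ∑ A, (slicePt J (sliceCoeff f₀ f₁ A z) : Cl d) * e A := by
  conv_lhs => rw [eq_sum_e (f₀ z), eq_sum_e (f₁ z)]
  rw [Finset.mul_sum, ← Finset.sum_add_distrib]
  refine Finset.sum_congr rfl fun A _ => ?_
  rw [coe_slicePt, add_mul, smul_mul_assoc, smul_mul_assoc, one_mul, mul_smul_comm]
  rfl

theorem _root_.ContinuousOn.cl_mul {α : Type*} [TopologicalSpace α] {a b : α → Cl d} {S : Set α}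
    (ha : ContinuousOn a S) (hb : ContinuousOn b S) : ContinuousOn (fun t => a t * b t) S :=
  ContinuousOn.clm_apply ((continuous_lmul (H := ℝ)).comp_continuousOn ha) hb

end SlicePair

section Pointwise

theorem lmul_slicePt_apply (J : Paravector d) (a : ℂ) (v : HMod d H) :
    lmul (slicePt J a : Cl d) v = a.re • v + a.im • lmul (J : Cl d) v := by
  rw [coe_slicePt, lmul_add, lmul_smul, lmul_smul, lmul_one]
  rfl

theorem lmul_lmul_of_mem (hJ : J ∈ imUnits d) (v : HMod d H) :
    lmul (J : Cl d) (lmul (J : Cl d) v) = -v := by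
  rw [← ContinuousLinearMap.comp_apply, ← lmul_mul, coe_mul_self_of_mem hJ, lmul_neg, lmul_one]
  rfl

/-- With X = (x - T)Rv and Y = -yRv one has S_R⁻¹v = X + JY. Multiplication by a in ℂ_J is complex
multiplication with J as imaginary unit, and in the J-part the factor J passes to w as conj(J). -/
theorem inner_lmul_SR (hJ : J ∈ imUnits d) (z a : ℂ) (v w : HMod d H) :
    ⟪lmul (slicePt J a : Cl d) (SR T (slicePt J z) v), w⟫_ℝ =
      (a * resolventForm T J v w z).re +
        (a * resolventForm T J v (lmul (conj (J : Cl d)) w) z).im := by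
  have h1 : SR T (slicePt J z) v = z.re • Qinv T (slicePt J z) v -
      z.im • lmul (J : Cl d) (Qinv T (slicePt J z) v) - TQinv T (slicePt J z) v := by
    rw [SR, conj_slicePt hJ]
    change lmul (slicePt J (starRingEnd ℂ z) : Cl d) (Qinv T (slicePt J z) v) -
      TQinv T (slicePt J z) v = _
    rw [lmul_slicePt_apply, Complex.conj_re, Complex.conj_im, neg_smul, ← sub_eq_add_neg]
  rw [lmul_slicePt_apply, h1, map_sub, map_sub, map_smul, map_smul, lmul_lmul_of_mem hJ]
  simp only [resolventForm, ← inner_lmul_left, inner_add_left, inner_sub_left,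
    real_inner_smul_left, inner_neg_left, Complex.mul_re, Complex.mul_im]
  ring

/-- Here the elements of ℂ_J act before R and A, so the factor J stays on v. -/
theorem inner_SL_lmul (hJ : J ∈ imUnits d) (z a : ℂ) (v w : HMod d H) :
    ⟪SL T (slicePt J z) (lmul (slicePt J a : Cl d) v), w⟫_ℝ =
      (a * resolventForm T J v w z).re +
        (a * resolventForm T J (lmul (J : Cl d) v) w z).im := by
  have h1 : SL T (slicePt J z) (lmul (slicePt J a : Cl d) v) =
      Qinv T (slicePt J z) (lmul (slicePt J (starRingEnd ℂ z * a) : Cl d) v) -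
        TQinv T (slicePt J z) (lmul (slicePt J a : Cl d) v) := by
    rw [SL, conj_slicePt hJ, coe_slicePt_mul hJ, lmul_mul]
    rfl
  rw [h1, lmul_slicePt_apply, lmul_slicePt_apply, map_add, map_add, map_smul, map_smul, map_smul,
    map_smul]
  simp only [resolventForm, inner_add_left, inner_sub_left,
    real_inner_smul_left, Complex.mul_re, Complex.mul_im, Complex.conj_re, Complex.conj_im]
  ring

theorem Contour.dsJ_eq (C : Contour T K) (k : Fin C.n) (t : ℝ) :
    C.dsJ k t = (slicePt C.J (-Complex.I * deriv (C.γ k) t) : Cl d) := by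
  rw [coe_slicePt_mul C.J_mem, Contour.dsJ]
  congr 1
  rw [coe_slicePt]
  simp

theorem Contour.lmul_dsJ (C : Contour T K) (k : Fin C.n) (t : ℝ) :
    lmul (H := H) (C.dsJ k t) = (deriv (C.γ k) t).im • lmul (1 : Cl d) +
      (deriv (C.γ k) t).re • lmul (-(C.J : Cl d)) := by
  rw [C.dsJ_eq]
  ext1 v
  rw [lmul_slicePt_apply]
  simp [lmul_one, lmul_neg]

end Pointwise

section Pairing

variable [CompleteSpace H] {f : Paravector d → Cl d} {f₀ f₁ : ℂ → Cl d} (C : Contour T K)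

namespace Contour

theorem continuousOn_Qinv (hT : IsClosedRightLinear T) (k : Fin C.n) :
    ContinuousOn (fun t => Qinv T (C.pt k t)) (Icc 0 1) := fun t ht =>
  ContinuousAt.comp_continuousWithinAt (f := C.γ k)
    (continuousAt_Qinv_slicePt hT C.J_mem (C.pt_mem_rhoS k ht))
    ((C.boundary.curve k).continuousOn t ht)

theorem continuousOn_TQinv (hT : IsClosedRightLinear T) (k : Fin C.n) :
    ContinuousOn (fun t => TQinv T (C.pt k t)) (Icc 0 1) := fun t ht =>
  ContinuousAt.comp_continuousWithinAt (f := C.γ k)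
    (continuousAt_TQinv_slicePt hT C.J_mem (C.pt_mem_rhoS k ht))
    ((C.boundary.curve k).continuousOn t ht)

omit [CompleteSpace H] in
theorem continuousOn_lmul_conj_pt (k : Fin C.n) :
    ContinuousOn (fun t => lmul (H := H) (conj (C.pt k t : Cl d))) (Icc 0 1) := by
  refine continuous_lmul.comp_continuousOn ((conjIsometry d).continuous.comp_continuousOn ?_)
  exact (continuous_subtype_val.comp (continuous_slicePt C.J)).comp_continuousOn
    (C.boundary.curve k).continuousOn

theorem continuousOn_SL (hT : IsClosedRightLinear T) (k : Fin C.n) :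
    ContinuousOn (fun t => SL T (C.pt k t)) (Icc 0 1) :=
  ((C.continuousOn_Qinv hT k).clm_comp (C.continuousOn_lmul_conj_pt k)).sub
    (C.continuousOn_TQinv hT k)

theorem continuousOn_SR (hT : IsClosedRightLinear T) (k : Fin C.n) :
    ContinuousOn (fun t => SR T (C.pt k t)) (Icc 0 1) :=
  ((C.continuousOn_lmul_conj_pt k).clm_comp (C.continuousOn_Qinv hT k)).sub
    (C.continuousOn_TQinv hT k)

omit [CompleteSpace H] in
theorem continuousOn_comp_γ (hK : AxiallySymmetric K) {g : ℂ → Cl d}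
    (hg : ContinuousOn g (profile Kᶜ)) (k : Fin C.n) :
    ContinuousOn (fun t => g (C.γ k t)) (Icc 0 1) :=
  hg.comp (C.boundary.curve k).continuousOn fun _ ht => C.γ_mem_profile hK k ht

theorem inner_integral_left (hT : IsClosedRightLinear T) (k : Fin C.n)
    (hf : ContinuousOn (fun t => f (C.pt k t)) (Icc 0 1)) (v w : HMod d H) :
    ⟪(∫ t in (0 : ℝ)..1, SL T (C.pt k t) ∘L lmul (C.dsJ k t) ∘L lmul (f (C.pt k t))) v, w⟫_ℝ =
      ∫ t in (0 : ℝ)..1, ⟪SL T (C.pt k t) (lmul (C.dsJ k t) (lmul (f (C.pt k t)) v)), w⟫_ℝ := by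
  have hl := (continuous_lmul (H := H)).comp_continuousOn hf
  have h : ∀ a : Cl d, ContinuousOn
      (fun t => SL T (C.pt k t) ∘L lmul a ∘L lmul (H := H) (f (C.pt k t))) (Icc 0 1) := fun a =>
    (C.continuousOn_SL hT k).clm_comp (continuousOn_const.clm_comp hl)
  refine inner_intervalIntegral_apply (C.boundary.curve k).intervalIntegrable_deriv (h 1)
    (h (-(C.J : Cl d))) (fun t u => ?_) v w
  simp [C.lmul_dsJ]

theorem inner_integral_right (hT : IsClosedRightLinear T) (k : Fin C.n)
    (hf : ContinuousOn (fun t => f (C.pt k t)) (Icc 0 1)) (v w : HMod d H) :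
    ⟪(∫ t in (0 : ℝ)..1, lmul (f (C.pt k t)) ∘L lmul (C.dsJ k t) ∘L SR T (C.pt k t)) v, w⟫_ℝ =
      ∫ t in (0 : ℝ)..1, ⟪lmul (f (C.pt k t)) (lmul (C.dsJ k t) (SR T (C.pt k t) v)), w⟫_ℝ := by
  have hl := (continuous_lmul (H := H)).comp_continuousOn hf
  have h : ∀ a : Cl d, ContinuousOn
      (fun t => lmul (H := H) (f (C.pt k t)) ∘L lmul a ∘L SR T (C.pt k t)) (Icc 0 1) := fun a =>
    hl.clm_comp (continuousOn_const.clm_comp (C.continuousOn_SR hT k))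
  refine inner_intervalIntegral_apply (C.boundary.curve k).intervalIntegrable_deriv (h 1)
    (h (-(C.J : Cl d))) (fun t u => ?_) v w
  simp [C.lmul_dsJ]

theorem intervalIntegrable_form (hT : IsClosedRightLinear T) (hK : AxiallySymmetric K)
    {F : ℂ → ℂ} (hF : DifferentiableOn ℂ F (profile Kᶜ)) (v w : HMod d H) (k : Fin C.n) :
    IntervalIntegrable (fun t => F (C.γ k t) * (-Complex.I * deriv (C.γ k) t) *
      resolventForm T C.J v w (C.γ k t)) volume 0 1 := by
  have h := (intervalIntegrable_comp_mul_deriv (C.boundary.curve k).continuousOn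
    (C.boundary.curve k).intervalIntegrable_deriv
    (S := {z | slicePt C.J z ∈ rhoS T} ∩ profile Kᶜ)
    (fun t ht => ⟨C.pt_mem_rhoS k ht, C.γ_mem_profile hK k ht⟩)
    (differentiableOn_mul_resolventForm hT C.J_mem hF v w).continuousOn).const_mul (-Complex.I)
  refine h.congr fun t _ => ?_
  ring

omit [CompleteSpace H] in
theorem form_eq_sum (F : ℂ → ℂ) (v w : HMod d H) :
    C.form F v w = ∑ k, ∫ t in (0 : ℝ)..1, F (C.γ k t) * (-Complex.I * deriv (C.γ k) t) *
      resolventForm T C.J v w (C.γ k t) := by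
  rw [form, Finset.mul_sum]
  refine Finset.sum_congr rfl fun k _ => ?_
  rw [curveInt, ← intervalIntegral.integral_const_mul]
  refine intervalIntegral.integral_congr fun t _ => ?_
  ring

/-- Sums of real and imaginary parts of the integrands of the scalar integrals. -/
theorem sum_integral_re_add_im (hT : IsClosedRightLinear T) (hK : AxiallySymmetric K)
    (hKc : IsClosed K) {ι : Type*} [Fintype ι] {F : ι → ℂ → ℂ}
    (hF : ∀ i, DifferentiableOn ℂ (F i) (profile Kᶜ))
    (hFc : ∀ i, ∀ z ∈ profile Kᶜ, F i (starRingEnd ℂ z) = starRingEnd ℂ (F i z))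
    (v w v' w' : ι → HMod d H) :
    ∑ k, ∫ t in (0 : ℝ)..1, ∑ i, ((F i (C.γ k t) * (-Complex.I * deriv (C.γ k) t) *
        resolventForm T C.J (v i) (w i) (C.γ k t)).re +
      (F i (C.γ k t) * (-Complex.I * deriv (C.γ k) t) *
        resolventForm T C.J (v' i) (w' i) (C.γ k t)).im) = ∑ i, (C.form (F i) (v i) (w i)).re := by
  have h1 := fun k i => C.intervalIntegrable_form hT hK (hF i) (v i) (w i) k
  have h2 := fun k i => C.intervalIntegrable_form hT hK (hF i) (v' i) (w' i) k
  simp only [fun k => intervalIntegral_sum_re_add_im (h1 k) (h2 k)]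
  rw [Finset.sum_comm]
  refine Finset.sum_congr rfl fun i _ => ?_
  -- The imaginary terms form the imaginary part of a real integral; this removes J from the result.
  rw [Finset.sum_add_distrib, ← Complex.re_sum, ← Complex.im_sum, ← form_eq_sum, ← form_eq_sum,
    C.form_im hT hK hKc (hF i) (hFc i), add_zero]

end Contour

theorem inner_leftCalc (hT : IsClosedRightLinear T) (hK : AxiallySymmetric K) (hKc : IsClosed K)
    (h : IsSlicePair f₀ f₁ (profile Kᶜ))
    (hf : ∀ z ∈ profile Kᶜ, ∀ J ∈ imUnits d, f (slicePt J z) = f₀ z + (J : Cl d) * f₁ z)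
    (v w : HMod d H) : ⟪leftCalc f C v, w⟫_ℝ = ⟪lmul (atInfinity f) v, w⟫_ℝ -
      (2 * Real.pi)⁻¹ * ∑ A, (C.form (sliceCoeff f₀ f₁ A) (lmul (e A) v) w).re := by
  have hpt : ∀ k, ∀ t ∈ Icc (0 : ℝ) 1,
      f (C.pt k t) = f₀ (C.γ k t) + (C.J : Cl d) * f₁ (C.γ k t) := fun k t ht =>
    hf _ (C.γ_mem_profile hK k ht) _ C.J_mem
  have hcont : ∀ k, ContinuousOn (fun t => f (C.pt k t)) (Icc 0 1) := fun k =>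
    ((C.continuousOn_comp_γ hK h.contDiff₀.continuousOn k).add
      (continuousOn_const.cl_mul (C.continuousOn_comp_γ hK h.contDiff₁.continuousOn k))).congr
      (hpt k)
  have hopen := isOpen_profile hK hKc C.J_mem
  rw [← C.sum_integral_re_add_im hT hK hKc (fun A => h.differentiableOn_sliceCoeff hopen A)
    (fun A z hz => h.sliceCoeff_conj A hz) (fun A => lmul (e A) v) (fun _ => w)
    (fun A => lmul (C.J : Cl d) (lmul (e A) v)) (fun _ => w)]
  simp only [leftCalc, sub_apply, smul_apply, sum_apply, inner_sub_left, real_inner_smul_left, sum_inner]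
  congr 2
  refine Finset.sum_congr rfl fun k _ => ?_
  rw [C.inner_integral_left hT k (hcont k)]
  refine intervalIntegral.integral_congr fun t ht => ?_
  rw [uIcc_of_le zero_le_one] at ht
  have h1 : lmul (H := H) (C.dsJ k t) (lmul (f (C.pt k t)) v) = ∑ A, lmul
      (slicePt C.J (sliceCoeff f₀ f₁ A (C.γ k t) * (-Complex.I * deriv (C.γ k) t)) : Cl d)
      (lmul (e A) v) := by
    rw [hpt k t ht, add_mul_eq_sum_sliceCoeff', lmul_sum, sum_apply, map_sum]
    refine Finset.sum_congr rfl fun A _ => ?_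
    -- ds_J and F_A both lie in ℂ_J, so their order may be exchanged.
    rw [lmul_mul, C.dsJ_eq, mul_comm (sliceCoeff f₀ f₁ A _),
      coe_slicePt_mul C.J_mem (-Complex.I * _) (sliceCoeff f₀ f₁ A _),
      lmul_mul (slicePt C.J (-Complex.I * _) : Cl d)]
    rfl
  rw [h1, map_sum, sum_inner]
  exact Finset.sum_congr rfl fun A _ => inner_SL_lmul C.J_mem _ _ _ _

theorem inner_rightCalc (hT : IsClosedRightLinear T) (hK : AxiallySymmetric K) (hKc : IsClosed K)
    (h : IsSlicePair f₀ f₁ (profile Kᶜ))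
    (hf : ∀ z ∈ profile Kᶜ, ∀ J ∈ imUnits d, f (slicePt J z) = f₀ z + f₁ z * (J : Cl d))
    (v w : HMod d H) : ⟪rightCalc f C v, w⟫_ℝ = ⟪lmul (atInfinity f) v, w⟫_ℝ -
      (2 * Real.pi)⁻¹ * ∑ A, (C.form (sliceCoeff f₀ f₁ A) v (lmul (conj (e A)) w)).re := by
  have hpt : ∀ k, ∀ t ∈ Icc (0 : ℝ) 1,
      f (C.pt k t) = f₀ (C.γ k t) + f₁ (C.γ k t) * (C.J : Cl d) := fun k t ht =>
    hf _ (C.γ_mem_profile hK k ht) _ C.J_mem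
  have hcont : ∀ k, ContinuousOn (fun t => f (C.pt k t)) (Icc 0 1) := fun k =>
    ((C.continuousOn_comp_γ hK h.contDiff₀.continuousOn k).add
      ((C.continuousOn_comp_γ hK h.contDiff₁.continuousOn k).cl_mul continuousOn_const)).congr
      (hpt k)
  have hopen := isOpen_profile hK hKc C.J_mem
  rw [← C.sum_integral_re_add_im hT hK hKc (fun A => h.differentiableOn_sliceCoeff hopen A)
    (fun A z hz => h.sliceCoeff_conj A hz) (fun _ => v) (fun A => lmul (conj (e A)) w)
    (fun _ => v) (fun A => lmul (conj (C.J : Cl d)) (lmul (conj (e A)) w))]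
  simp only [rightCalc, sub_apply, smul_apply, sum_apply, inner_sub_left, real_inner_smul_left, sum_inner]
  congr 2
  refine Finset.sum_congr rfl fun k _ => ?_
  rw [C.inner_integral_right hT k (hcont k)]
  refine intervalIntegral.integral_congr fun t ht => ?_
  rw [uIcc_of_le zero_le_one] at ht
  have h1 : lmul (H := H) (f (C.pt k t)) (lmul (C.dsJ k t) (SR T (C.pt k t) v)) =
      ∑ A, lmul (e A) (lmul
        (slicePt C.J (sliceCoeff f₀ f₁ A (C.γ k t) * (-Complex.I * deriv (C.γ k) t)) : Cl d)
        (SR T (C.pt k t) v)) := by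
    rw [hpt k t ht, add_mul_eq_sum_sliceCoeff, lmul_sum, sum_apply]
    refine Finset.sum_congr rfl fun A _ => ?_
    rw [lmul_mul, C.dsJ_eq, coe_slicePt_mul C.J_mem (sliceCoeff f₀ f₁ A _),
      lmul_mul (slicePt C.J (sliceCoeff f₀ f₁ A _) : Cl d)]
    rfl
  rw [h1, sum_inner]
  refine Finset.sum_congr rfl fun A _ => ?_
  -- The outer factor e_A goes over to w as conj(e_A).
  rw [inner_lmul_left]
  exact inner_lmul_SR C.J_mem _ _ _ _

end Pairing

end CliffordSFC

/-! ### The function f^# and the adjoint formulas. -/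

namespace CliffordSFC

open Filter Topology Set

variable {d : ℕ} {K : Set (Paravector d)} {f : Paravector d → Cl d} {f₀ f₁ : ℂ → Cl d}

section Sharp

theorem conj_mem_profile {U : Set (Paravector d)} {z : ℂ} (hz : z ∈ profile U) :
    starRingEnd ℂ z ∈ profile U := fun J hJ => by
  rw [← slicePt_neg]
  exact hz _ (neg_mem_imUnits hJ)

theorem IsSlicePair.conj {D : Set ℂ} (h : IsSlicePair f₀ f₁ D) :
    IsSlicePair (fun z => conj (f₀ z)) (fun z => conj (f₁ z)) D := by
  have hd : ∀ (g : ℂ → Cl d) (z ζ : ℂ),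
      fderiv ℝ (fun z => CliffordSFC.conj (g z)) z ζ = CliffordSFC.conj (fderiv ℝ g z ζ) := by
    intro g z ζ
    have := (conjIsometry d).toContinuousLinearEquiv.comp_fderiv (f := g) (x := z)
    exact DFunLike.congr_fun this ζ
  have hneg : ∀ a : Cl d, CliffordSFC.conj (-a) = -CliffordSFC.conj a := map_neg (conjIsometry d)
  refine ⟨?_, ?_, fun z hz => ?_, fun z hz => ?_, fun z hz => ?_, fun z hz => ?_⟩
  · exact (conjIsometry d).contDiff.comp_contDiffOn h.contDiff₀
  · exact (conjIsometry d).contDiff.comp_contDiffOn h.contDiff₁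
  · rw [h.even z hz]
  · rw [h.odd z hz, hneg]
  · rw [hd, hd, h.cauchyRiemann₁ z hz]
  · rw [hd, hd, h.cauchyRiemann₂ z hz, hneg]

theorem conj_add (a b : Cl d) : conj (a + b) = conj a + conj b := map_add (conjIsometry d) a b

/-- Conjugation reverses products, which carries J to the right; the sign from oddness of f_1
cancels the one from conj(J) = -J. -/
theorem sharp_slicePt_of_left {D : Set ℂ} (h : IsSlicePair f₀ f₁ D) {z : ℂ} (hz : z ∈ D)
    {J : Paravector d} (hJ : J ∈ imUnits d)
    (hf : f (slicePt J (starRingEnd ℂ z)) =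
      f₀ (starRingEnd ℂ z) + (J : Cl d) * f₁ (starRingEnd ℂ z)) :
    sharp f (slicePt J z) = conj (f₀ z) + conj (f₁ z) * (J : Cl d) := by
  rw [sharp, pconj_slicePt hJ, hf, h.even z hz, h.odd z hz, mul_neg, ← neg_mul, conj_add, conj_mul,
    ← conj_coe_of_mem hJ, conj_conj]

theorem sharp_slicePt_of_right {D : Set ℂ} (h : IsSlicePair f₀ f₁ D) {z : ℂ} (hz : z ∈ D)
    {J : Paravector d} (hJ : J ∈ imUnits d)
    (hf : f (slicePt J (starRingEnd ℂ z)) =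
      f₀ (starRingEnd ℂ z) + f₁ (starRingEnd ℂ z) * (J : Cl d)) :
    sharp f (slicePt J z) = conj (f₀ z) + (J : Cl d) * conj (f₁ z) := by
  rw [sharp, pconj_slicePt hJ, hf, h.even z hz, h.odd z hz, neg_mul, ← mul_neg, conj_add, conj_mul,
    ← conj_coe_of_mem hJ, conj_conj]

theorem sliceCoeff_conj_apply (A : Finset (Fin d)) (z : ℂ) :
    sliceCoeff (fun z => conj (f₀ z)) (fun z => conj (f₁ z)) A z =
      (sgn A A : ℂ) * sliceCoeff f₀ f₁ A z := by
  apply Complex.ext <;> simp [sliceCoeff, conj_apply]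

theorem norm_pconj (s : Paravector d) : ‖pconj s‖ = ‖s‖ := (conjIsometry d).norm_map s

theorem tendsto_sharp {l : Cl d} (h : Tendsto f (Bornology.cobounded (Paravector d)) (𝓝 l)) :
    Tendsto (sharp f) (Bornology.cobounded (Paravector d)) (𝓝 (conj l)) := by
  have h1 : Tendsto pconj (Bornology.cobounded (Paravector d))
      (Bornology.cobounded (Paravector d)) := by
    rw [← tendsto_norm_atTop_iff_cobounded]
    simp only [norm_pconj]
    exact tendsto_norm_cobounded_atTop
  exact ((conjIsometry d).continuous.tendsto l).comp (h.comp h1)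

theorem atInfinity_eq {l : Cl d} (h : Tendsto f (Bornology.cobounded (Paravector d)) (𝓝 l)) :
    atInfinity f = l := by
  -- The paravectors contain ℝ even for d = 0, so the filter at infinity is proper and limits are
  -- unique.
  have : Nontrivial (Paravector d) := by
    refine ⟨⟨ofReal 1, 0, fun h => ?_⟩⟩
    have h1 : (ofReal 1 : Paravector d).1 ∅ = 0 := by rw [h]; rfl
    rw [coe_ofReal] at h1
    simp [one_def] at h1
  exact h.limUnder_eq

theorem atInfinity_sharp (h : ∃ l, Tendsto f (Bornology.cobounded (Paravector d)) (𝓝 l)) :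
    atInfinity (sharp f) = conj (atInfinity f) := by
  obtain ⟨l, hl⟩ := h
  rw [atInfinity_eq hl, atInfinity_eq (tendsto_sharp hl)]

theorem atInfinity_congr {g : Paravector d → Cl d} (hK : IsCompact K) (h : ∀ s ∉ K, f s = g s) :
    atInfinity f = atInfinity g := by
  have h1 : f =ᶠ[Bornology.cobounded (Paravector d)] g := by
    filter_upwards [Bornology.isBounded_def.1 hK.isBounded] with s hs using h s hs
  rw [atInfinity, atInfinity, limUnder, limUnder, map_congr h1]

end Sharp

variable {H : Type*} [NormedAddCommGroup H] [InnerProductSpace ℝ H]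
  {T : HMod d H →ₗ.[ℝ] HMod d H}

theorem rightCalc_congr {g : Paravector d → Cl d} (hK : IsCompact K) (h : ∀ s ∉ K, f s = g s)
    (C : Contour T K) : rightCalc f C = rightCalc g C := by
  rw [rightCalc, rightCalc, atInfinity_congr hK h]
  congr 2
  refine Finset.sum_congr rfl fun k _ => intervalIntegral.integral_congr fun t ht => ?_
  rw [uIcc_of_le zero_le_one] at ht
  beta_reduce
  rw [h _ (C.pt_notMem k ht)]

theorem resolventForm_smul_left (J : Paravector d) (r : ℝ) (v w : HMod d H) (z : ℂ) :
    resolventForm T J (r • v) w z = r * resolventForm T J v w z := by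
  apply Complex.ext <;> simp [resolventForm, real_inner_smul_left] <;> ring

theorem resolventForm_smul_right (J : Paravector d) (r : ℝ) (v w : HMod d H) (z : ℂ) :
    resolventForm T J v (r • w) z = r * resolventForm T J v w z := by
  apply Complex.ext <;> simp [resolventForm, real_inner_smul_right] <;> ring

theorem ofReal_sgn_mul_self (A B : Finset (Fin d)) : (sgn A B : ℂ) * (sgn A B : ℂ) = 1 := by
  exact_mod_cast sgn_mul_self A B

/-- The sign of conj(e_A) occurs twice, in the coefficient and in the vector, and squares to 1. -/
theorem Contour.form_conj_right (C : Contour T K) (A : Finset (Fin d)) (v w : HMod d H) :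
    C.form (sliceCoeff (fun z => conj (f₀ z)) (fun z => conj (f₁ z)) A) v (lmul (conj (e A)) w) =
      C.form (sliceCoeff f₀ f₁ A) v (lmul (e A) w) := by
  rw [form, form]
  refine congrArg _ (Finset.sum_congr rfl fun k _ => congrArg _ (funext fun z => ?_))
  rw [sliceCoeff_conj_apply, conj_e, lmul_smul]
  refine (congrArg _ (resolventForm_smul_right C.J (sgn A A) v (lmul (e A) w) z)).trans ?_
  linear_combination (sliceCoeff f₀ f₁ A z * resolventForm T C.J v (lmul (e A) w) z) *
    ofReal_sgn_mul_self A A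

theorem Contour.form_conj_left (C : Contour T K) (A : Finset (Fin d)) (v w : HMod d H) :
    C.form (sliceCoeff (fun z => conj (f₀ z)) (fun z => conj (f₁ z)) A) (lmul (e A) v) w =
      C.form (sliceCoeff f₀ f₁ A) (lmul (conj (e A)) v) w := by
  rw [form, form]
  refine congrArg _ (Finset.sum_congr rfl fun k _ => congrArg _ (funext fun z => ?_))
  rw [sliceCoeff_conj_apply, conj_e, lmul_smul]
  refine Eq.trans ?_ (congrArg _ (resolventForm_smul_left C.J (sgn A A) (lmul (e A) v) w z)).symm
  ring

theorem Contour.form_eq_zero (C : Contour T K) (hK : AxiallySymmetric K) {F : ℂ → ℂ}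
    (hF : ∀ z ∈ profile Kᶜ, F z = 0) (v w : HMod d H) : C.form F v w = 0 := by
  have h : ∀ k, curveInt (C.γ k) (fun z => F z * resolventForm T C.J v w z) = 0 := by
    intro k
    rw [curveInt_congr (h := fun _ => 0) fun t ht => by
      rw [hF _ (C.γ_mem_profile hK k ht), zero_mul]]
    simp [curveInt]
  simp [form, h]

theorem algebraMap_apply_of_ne_empty (r : ℝ) {A : Finset (Fin d)} (hA : A ≠ ∅) :
    algebraMap ℝ (Cl d) r A = 0 := by
  rw [Algebra.algebraMap_eq_smul_one]
  simp [one_def, hA]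

theorem sliceCoeff_eq_zero_of_real {z : ℂ} (h₀ : ∃ r : ℝ, f₀ z = algebraMap ℝ (Cl d) r)
    (h₁ : ∃ r : ℝ, f₁ z = algebraMap ℝ (Cl d) r) {A : Finset (Fin d)} (hA : A ≠ ∅) :
    sliceCoeff f₀ f₁ A z = 0 := by
  obtain ⟨r, hr⟩ := h₀
  obtain ⟨r', hr'⟩ := h₁
  apply Complex.ext <;>
    simp [sliceCoeff, hr, hr', algebraMap_apply_of_ne_empty _ hA]

/-- Only A = ∅ has a nonzero coefficient, and e_∅ = 1. -/
theorem Contour.form_left_eq_right_of_real (C : Contour T K) (hK : AxiallySymmetric K)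
    (hreal : ∀ z ∈ profile Kᶜ, (∃ r : ℝ, f₀ z = algebraMap ℝ (Cl d) r) ∧
      ∃ r : ℝ, f₁ z = algebraMap ℝ (Cl d) r) (A : Finset (Fin d)) (v w : HMod d H) :
    C.form (sliceCoeff f₀ f₁ A) v (lmul (conj (e A)) w) =
      C.form (sliceCoeff f₀ f₁ A) (lmul (e A) v) w := by
  by_cases hA : A = ∅
  · subst hA
    rw [e_empty, conj_one, lmul_one, ContinuousLinearMap.id_apply, ContinuousLinearMap.id_apply]
  · have h0 : ∀ z ∈ profile Kᶜ, sliceCoeff f₀ f₁ A z = 0 := fun z hz =>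
      sliceCoeff_eq_zero_of_real (hreal z hz).1 (hreal z hz).2 hA
    rw [C.form_eq_zero hK h0, C.form_eq_zero hK h0]

variable [CompleteSpace H]

theorem IsClosedRightLinear.adjoint (hT : IsClosedRightLinear T)
    (hdense : Dense (T.domain : Set (HMod d H))) : IsClosedRightLinear T.adjoint :=
  ⟨hT.1.adjoint hdense, LinearPMap.adjoint_isClosed hdense⟩

/-- Matrix coefficients are compared for each A: the form for T* at (e_A v, w) on one contour equals
that on the other contour transported to T*, which is the form for T at (w, e_A v). -/
theorem leftCalc_adjoint (hT : IsClosedRightLinear T) (hdense : Dense (T.domain : Set (HMod d H)))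
    (hKc : IsCompact K) (hK : AxiallySymmetric K)
    (hlim : ∃ l, Tendsto f (Bornology.cobounded (Paravector d)) (𝓝 l))
    (h : IsSlicePair f₀ f₁ (profile Kᶜ))
    (hf : ∀ z ∈ profile Kᶜ, ∀ J ∈ imUnits d, f (slicePt J z) = f₀ z + (J : Cl d) * f₁ z)
    (C : Contour T.adjoint K) (C' : Contour T K) :
    leftCalc f C = ContinuousLinearMap.adjoint (rightCalc (sharp f) C') := by
  have hT' := hT.adjoint hdense
  refine ContinuousLinearMap.ext fun v => ext_inner_right ℝ fun w => ?_
  rw [ContinuousLinearMap.adjoint_inner_left, real_inner_comm (rightCalc (sharp f) C' w),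
    inner_leftCalc C hT' hK hKc.isClosed h hf,
    inner_rightCalc C' hT hK hKc.isClosed h.conj fun z hz J hJ =>
      sharp_slicePt_of_left h hz hJ (hf _ (conj_mem_profile hz) J hJ),
    atInfinity_sharp hlim, inner_lmul_left, real_inner_comm]
  congr 2
  refine Finset.sum_congr rfl fun A _ => ?_
  rw [C'.form_conj_right, C.form_eq hT' hK hKc.isClosed
    (h.differentiableOn_sliceCoeff (isOpen_profile hK hKc.isClosed C.J_mem) A)
    (C'.toAdjoint hT.2 hdense), C'.form_toAdjoint]

theorem rightCalc_adjoint (hT : IsClosedRightLinear T) (hdense : Dense (T.domain : Set (HMod d H)))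
    (hKc : IsCompact K) (hK : AxiallySymmetric K)
    (hlim : ∃ l, Tendsto f (Bornology.cobounded (Paravector d)) (𝓝 l))
    (h : IsSlicePair f₀ f₁ (profile Kᶜ))
    (hf : ∀ z ∈ profile Kᶜ, ∀ J ∈ imUnits d, f (slicePt J z) = f₀ z + f₁ z * (J : Cl d))
    (C : Contour T.adjoint K) (C' : Contour T K) :
    rightCalc f C = ContinuousLinearMap.adjoint (leftCalc (sharp f) C') := by
  have hT' := hT.adjoint hdense
  refine ContinuousLinearMap.ext fun v => ext_inner_right ℝ fun w => ?_
  rw [ContinuousLinearMap.adjoint_inner_left, real_inner_comm (leftCalc (sharp f) C' w),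
    inner_rightCalc C hT' hK hKc.isClosed h hf,
    inner_leftCalc C' hT hK hKc.isClosed h.conj fun z hz J hJ =>
      sharp_slicePt_of_right h hz hJ (hf _ (conj_mem_profile hz) J hJ),
    atInfinity_sharp hlim, inner_lmul_left, real_inner_comm]
  congr 2
  refine Finset.sum_congr rfl fun A _ => ?_
  rw [C'.form_conj_left, C.form_eq hT' hK hKc.isClosed
    (h.differentiableOn_sliceCoeff (isOpen_profile hK hKc.isClosed C.J_mem) A)
    (C'.toAdjoint hT.2 hdense), C'.form_toAdjoint]

/-- The left and the right calculus agree for intrinsic functions. -/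
theorem Intrinsic.leftCalc_eq_rightCalc (hT : IsClosedRightLinear T) (hKc : IsCompact K)
    (hK : AxiallySymmetric K) (hf : Intrinsic f Kᶜ) (C : Contour T K) :
    leftCalc f C = rightCalc f C := by
  obtain ⟨f₀, f₁, h, hreal, hf⟩ := hf
  have hf' : ∀ z ∈ profile Kᶜ, ∀ J ∈ imUnits d,
      f (slicePt J z) = f₀ z + f₁ z * (J : Cl d) := fun z hz J hJ => by
    obtain ⟨r, hr⟩ := (hreal z hz).2
    rw [hf z hz J hJ, hr, Algebra.commutes]
  have key : ∀ v w : HMod d H, ⟪leftCalc f C v, w⟫_ℝ = ⟪rightCalc f C v, w⟫_ℝ := fun v w => by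
    rw [inner_leftCalc C hT hK hKc.isClosed h hf, inner_rightCalc C hT hK hKc.isClosed h hf',
      Finset.sum_congr rfl fun A _ =>
        congrArg Complex.re (C.form_left_eq_right_of_real hK hreal A v w)]
  exact ContinuousLinearMap.ext fun v => ext_inner_right ℝ fun w => key v w

/-- Real components are fixed by conjugation and commute with J. The unit J ensures that s lies in
some plane ℂ_I, where the slice condition determines f. -/
theorem Intrinsic.sharp_eq (hK : AxiallySymmetric K) (hf : Intrinsic f Kᶜ) {J : Paravector d}
    (hJ : J ∈ imUnits d) {s : Paravector d} (hs : s ∉ K) : sharp f s = f s := by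
  obtain ⟨f₀, f₁, h, hreal, hf⟩ := hf
  obtain ⟨I, hI, z, rfl⟩ := exists_eq_slicePt hJ s
  have hz : z ∈ profile Kᶜ := (mem_profile_compl_iff hK hI).2 hs
  have hconj : ∀ r : ℝ, conj (algebraMap ℝ (Cl d) r) = algebraMap ℝ (Cl d) r := fun r => by
    rw [Algebra.algebraMap_eq_smul_one, ← conjIsometry_apply, map_smul, conjIsometry_apply,
      conj_one]
  obtain ⟨⟨r, hr⟩, r', hr'⟩ := hreal z hz
  rw [sharp_slicePt_of_left h hz hI (hf _ (conj_mem_profile hz) I hI), hf z hz I hI, hr, hr', hconj,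
    hconj, Algebra.commutes]

end CliffordSFC

theorem mainTheorem4 (d : ℕ) {H : Type*} [NormedAddCommGroup H] [InnerProductSpace ℝ H]
    [CompleteSpace H]
    (T : CliffordSFC.HMod d H →ₗ.[ℝ] CliffordSFC.HMod d H)
    (hT : CliffordSFC.IsClosedRightLinear T)
    (hdense : Dense (T.domain : Set (CliffordSFC.HMod d H)))
    (K : Set (CliffordSFC.Paravector d)) (hKc : IsCompact K)
    (hKs : CliffordSFC.AxiallySymmetric K) (hKρ : K ⊆ CliffordSFC.rhoS T)
    (f : CliffordSFC.Paravector d → CliffordSFC.Cl d)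
    (hlim : ∃ l, Filter.Tendsto f (Bornology.cobounded (CliffordSFC.Paravector d)) (nhds l)) :
    -- the functional calculus of the adjoint, and the one of `T` at `f^#`, are defined
    CliffordSFC.IsClosedRightLinear T.adjoint ∧
    K ⊆ CliffordSFC.rhoS T.adjoint ∧
    (∃ l, Filter.Tendsto (CliffordSFC.sharp f)
      (Bornology.cobounded (CliffordSFC.Paravector d)) (nhds l)) ∧
    -- left slice hyperholomorphic functions
    (CliffordSFC.LeftSlice f Kᶜ →
      CliffordSFC.RightSlice (CliffordSFC.sharp f) Kᶜ ∧
      ∀ (C : CliffordSFC.Contour T.adjoint K) (C' : CliffordSFC.Contour T K),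
        CliffordSFC.leftCalc f C =
          ContinuousLinearMap.adjoint (CliffordSFC.rightCalc (CliffordSFC.sharp f) C')) ∧
    -- right slice hyperholomorphic functions
    (CliffordSFC.RightSlice f Kᶜ →
      CliffordSFC.LeftSlice (CliffordSFC.sharp f) Kᶜ ∧
      ∀ (C : CliffordSFC.Contour T.adjoint K) (C' : CliffordSFC.Contour T K),
        CliffordSFC.rightCalc f C =
          ContinuousLinearMap.adjoint (CliffordSFC.leftCalc (CliffordSFC.sharp f) C')) ∧
    -- intrinsic functions, for which both formulas may be used for either operator
    (CliffordSFC.Intrinsic f Kᶜ →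
      ∀ (C : CliffordSFC.Contour T.adjoint K) (C' : CliffordSFC.Contour T K),
        CliffordSFC.leftCalc f C = ContinuousLinearMap.adjoint (CliffordSFC.leftCalc f C') ∧
        CliffordSFC.leftCalc f C = ContinuousLinearMap.adjoint (CliffordSFC.rightCalc f C') ∧
        CliffordSFC.rightCalc f C = ContinuousLinearMap.adjoint (CliffordSFC.leftCalc f C') ∧
        CliffordSFC.rightCalc f C = ContinuousLinearMap.adjoint (CliffordSFC.rightCalc f C')) := by
  have hleft : CliffordSFC.LeftSlice f Kᶜ →
      ∀ (C : CliffordSFC.Contour T.adjoint K) (C' : CliffordSFC.Contour T K),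
        CliffordSFC.leftCalc f C =
          ContinuousLinearMap.adjoint (CliffordSFC.rightCalc (CliffordSFC.sharp f) C') := by
    rintro ⟨f₀, f₁, h, hf⟩
    exact CliffordSFC.leftCalc_adjoint hT hdense hKc hKs hlim h hf
  refine ⟨hT.adjoint hdense, fun s hs => CliffordSFC.slicePt_mem_rhoS_adjoint hT.2 hdense (hKρ hs),
    hlim.imp' _ fun l hl => CliffordSFC.tendsto_sharp hl, fun hf => ⟨?_, hleft hf⟩, ?_, ?_⟩
  · obtain ⟨f₀, f₁, h, hf⟩ := hf
    exact ⟨_, _, h.conj, fun z hz J hJ => CliffordSFC.sharp_slicePt_of_left h hz hJ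
      (hf _ (CliffordSFC.conj_mem_profile hz) J hJ)⟩
  · rintro ⟨f₀, f₁, h, hf⟩
    exact ⟨⟨_, _, h.conj, fun z hz J hJ => CliffordSFC.sharp_slicePt_of_right h hz hJ
      (hf _ (CliffordSFC.conj_mem_profile hz) J hJ)⟩,
      CliffordSFC.rightCalc_adjoint hT hdense hKc hKs hlim h hf⟩
  · intro hf C C'
    -- f^# and f agree only off K, which suffices because the calculus sees only the boundary curves
    -- and infinity.
    have h1 : CliffordSFC.leftCalc f C =
        ContinuousLinearMap.adjoint (CliffordSFC.rightCalc f C') := by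
      obtain ⟨f₀, f₁, h, -, hf'⟩ := id hf
      rw [hleft ⟨f₀, f₁, h, hf'⟩ C C',
        CliffordSFC.rightCalc_congr hKc (fun s hs => hf.sharp_eq hKs C.J_mem hs)]
    have h2 := hf.leftCalc_eq_rightCalc (hT.adjoint hdense) hKc hKs C
    have h3 := hf.leftCalc_eq_rightCalc hT hKc hKs C'
    exact ⟨h3 ▸ h1, h1, h2 ▸ h3 ▸ h1, h2 ▸ h1⟩
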